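/- Let $p,q:[0,\infty)\to[0,\infty)$ have finite supports $S(p)$, $S(q)$. A function $f:[0,\infty)\to[0,\infty)$ is operator monotone if $X\le Y$ implies $f(X)\le f(Y)$ for all positive semidefinite complex matrices $X,Y$ of every finite size, where $X\le Y$ means that $Y-X$ is positive semidefinite. The transition $p\to q$ is called strictly valid if $\sum_z p(z)=\sum_z q(z)$ and $\sum_z p(z)f(z)\le\sum_z q(z)f(z)$ for every continuous operator monotone function $f$, with strict inequality whenever $f$ is not constant. For a positive semidefinite matrix $Z$ and a vector $\psi$, let $\mathrm{Prob}(Z,\psi)$ be the function on $[0,\infty)$ whose value at $z$ is $\langle\psi,\Pi^{[z]}\psi\rangle$, where $\Pi^{[z]}$ is the orthogonal projection onto the eigenspace of $Z$ for $z$ (so the value is $0$ if $z$ is not an eigenvalue). Suppose that $p\to q$ is strictly valid. Then there are a real number $\Lambda>0$ larger than every element of $S(p)\cup S(q)$, positive semidefinite matrices $X\le Y$ of the same size, and an (unnormalized) vector $\psi$ such that $p=\mathrm{Prob}(X,\psi)$, $q=\mathrm{Prob}(Y,\psi)$, and: 1. the spectrum of $X$ is $\{0\}\cup S(p)$, or,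 only if $|S(q)|=1$, possibly just $S(p)$; every non-zero eigenvalue of $X$ occurs once; 2. the spectrum of $Y$ is $\{\Lambda\}\cup S(q)$, or, only if $|S(p)|=1$, possibly just $S(q)$; every eigenvalue of $Y$ other than $\Lambda$ occurs once; 3. the dimension of $X$ and $Y$ is at most $|S(p)|+|S(q)|-1$. Moreover, if in (3) the dimension is allowed to be at most $|S(p)|+|S(q)|$, then $\Lambda$, $X$, $Y$, $\psi$ can be chosen so that the spectra are exactly $\{0\}\cup S(p)$ and $\{\Lambda\}\cup S(q)$ in all cases, with the other properties unchanged. -/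

import Mathlib

open scoped NNReal ComplexOrder MatrixOrder

noncomputable section

/-- `f : [0,∞) → [0,∞)` is operator monotone: `X ≤ Y` implies `f(X) ≤ f(Y)` for all positive
semidefinite complex matrices `X`, `Y` of every finite size. The spectrum of a matrix is finite,
so `cfc f X` is always the matrix `∑ z, f z • Π^[z]`, the sum over the eigenvalues `z` of `X`. -/
def OperatorMonotone (f : ℝ≥0 → ℝ≥0) : Prop :=
  ∀ (n : ℕ) (X Y : Matrix (Fin n) (Fin n) ℂ),
    X.PosSemidef → Y.PosSemidef → X ≤ Y → cfc f X ≤ cfc f Y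

/-- The transition `p → q` is valid. The test functions are the continuous operator monotone
functions on `[0,∞)`. -/
def ValidTransition (p q : ℝ≥0 →₀ ℝ≥0) : Prop :=
  (∑ z ∈ p.support, p z = ∑ z ∈ q.support, q z) ∧
    ∀ f : ℝ≥0 → ℝ≥0, Continuous f → OperatorMonotone f →
      ∑ z ∈ p.support, p z * f z ≤ ∑ z ∈ q.support, q z * f z

/-- The transition `p → q` is strictly valid: it is valid, and the inequality is strict for every
non-constant test function. -/
def StrictlyValidTransition (p q : ℝ≥0 →₀ ℝ≥0) : Prop :=
  ValidTransition p q ∧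
    ∀ f : ℝ≥0 → ℝ≥0, Continuous f → OperatorMonotone f → (∃ x y, f x ≠ f y) →
      ∑ z ∈ p.support, p z * f z < ∑ z ∈ q.support, q z * f z

/-- The eigenspace of the matrix `Z` for the real number `z`; it is trivial if `z` is not an
eigenvalue of `Z`. -/
def eigSpace {n : ℕ} (Z : Matrix (Fin n) (Fin n) ℂ) (z : ℝ) :
    Submodule ℂ (EuclideanSpace ℂ (Fin n)) :=
  Module.End.eigenspace (Matrix.toEuclideanLin Z) (z : ℂ)

/-- `Prob(Z, ψ)`: the value at `z` is `⟨ψ| Π^[z] |ψ⟩`, where `Π^[z]` is the orthogonal projection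
onto the eigenspace of `Z` for `z` (so it is `0` if `z` is not an eigenvalue). -/
def Prob {n : ℕ} (Z : Matrix (Fin n) (Fin n) ℂ) (ψ : EuclideanSpace ℂ (Fin n)) (z : ℝ≥0) : ℝ :=
  (inner ℂ ψ ((eigSpace Z z).starProjection ψ)).re

/-- The support `S(p)` as a set of real numbers. -/
def realSupport (p : ℝ≥0 →₀ ℝ≥0) : Set ℝ := (fun z : ℝ≥0 => (z : ℝ)) '' (p.support : Set ℝ≥0)

/-- The positive semidefinite matrices `X ≤ Y` and the (unnormalized) vector `ψ` express the
transition `p → q`: `p = Prob(X, ψ)` and `q = Prob(Y, ψ)`. -/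
structure Expresses {n : ℕ} (p q : ℝ≥0 →₀ ℝ≥0) (X Y : Matrix (Fin n) (Fin n) ℂ)
    (ψ : EuclideanSpace ℂ (Fin n)) : Prop where
  posSemidef_left : X.PosSemidef
  posSemidef_right : Y.PosSemidef
  le : X ≤ Y
  prob_left : ∀ z, (p z : ℝ) = Prob X ψ z
  prob_right : ∀ z, (q z : ℝ) = Prob Y ψ z

/-- Every eigenvalue of `Z` other than `a` occurs once. -/
def SimpleExcept {n : ℕ} (Z : Matrix (Fin n) (Fin n) ℂ) (a : ℝ) : Prop :=
  ∀ z ∈ spectrum ℝ Z, z ≠ a → Module.finrank ℂ (eigSpace Z z) = 1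

end

/-! Write `P`, `Q` for the weights and `α`, `β` for the points of the two supports, and let `x`, `y`
be the square roots of the weights. It suffices to find orthonormal families `ξ`, `η` with `∑ x i •
ξ i = ∑ y j • η j` (this vector is `ψ`) such that `X`, equal to `α i` on `ξ i` and `0` on the
complement, lies below `Y`, equal to `β j` on `η j` and `Λ` on the complement. Only the real overlap
matrix `C i j = ⟪ξ i, η j⟫` matters.

Put `g z = Λ z / (Λ - z)`. Then `X ≤ Y` follows from `Cᵀ g(α) C ≤ g(β)`, because for `z > 0` the
reciprocal of `z` is the sum of those of `g z` and `Λ`: `Y` is the parallel sum of `Λ` with the form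
`g(β)` on the span of `η` (`spectralOperator_le`). The families exist as soon as `C y = x` and `CᵀC
≤ 1`. The Gram matrix of `ξ` and `η` together is then positive semidefinite with null vector `(x,
-y)`, which saves one dimension (`exists_orthonormal_families`).

Such a `C` comes from a finite-dimensional interpolation theorem (`exists_contraction`), which needs
`∑ P g(α)/(1 + s g(α)) ≤ ∑ Q g(β)/(1 + s g(β))` for all `s ≥ 0`. Up to a positive factor, `g/(1 + s
g)` is either `z/(1 + c z)` with `c ≥ 0`, which is operator monotone, or `K z/(K - z)` with `K ≥ Λ`,
which tends to `z` as `K` grows. Strictness of the inequality for `z` covers the second kind once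
`Λ` is large (`exists_cutoff`).

The interpolation theorem is proved by separation: an obstruction to `C` would be a pair of positive
semidefinite matrices, and against any such pair a good `C` is built row by row from a minimum over
a hyperplane (`exists_hyperplane_min`, `exists_le_trace`). -/

open scoped Matrix

/-! ### Minimum of a pencil of quadratic forms on a hyperplane -/

/-- The minimum of `‖w‖² + z ⟪w, σ w⟫` over the hyperplane `⟪v, w⟫ = 1`, as a function of `z ≥ 0`,
is a nonnegative combination of `1`, `z` and functions `z / (1 + s z)`. -/
theorem exists_hyperplane_min {H : Type*} [NormedAddCommGroup H] [InnerProductSpace ℝ H]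
    [FiniteDimensional ℝ H] (σ : H →ₗ[ℝ] H) (hσ : σ.IsPositive) (v : H) (hv : v ≠ 0) :
    ∃ (m : ℕ) (c₀ c₁ : ℝ) (d s : Fin m → ℝ), 0 ≤ c₁ ∧ (∀ k, 0 ≤ d k) ∧ (∀ k, 0 ≤ s k) ∧
      (∀ z : ℝ, 0 ≤ z → ∃ w : H, inner ℝ v w = 1 ∧
        ‖w‖ ^ 2 + z * inner ℝ w (σ w) = c₀ + c₁ * z + ∑ k, d k * (z / (1 + s k * z))) ∧
      (∀ z : ℝ, 0 ≤ z → ∀ w : H, inner ℝ v w = 1 →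
        c₀ + c₁ * z + ∑ k, d k * (z / (1 + s k * z)) ≤ ‖w‖ ^ 2 + z * inner ℝ w (σ w)) := by
  classical
  set U : Submodule ℝ H := (ℝ ∙ v)ᗮ with hU
  have hsymm : ∀ x y : H, inner ℝ (σ x) y = inner ℝ x (σ y) := hσ.isSymmetric
  have hpos : ∀ x : H, 0 ≤ inner ℝ x (σ x) := fun x => hσ.inner_nonneg_right x
  -- Diagonalizing the compression of `σ` to the direction space of the hyperplane decouples the
  -- problem into one-variable quadratics.
  let τ : U →ₗ[ℝ] U := U.orthogonalProjectionOnto.toLinearMap ∘ₗ σ ∘ₗ U.subtype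
  have hτi : ∀ x y : U, inner ℝ (τ x) y = inner ℝ (σ x : H) (y : H) := by
    intro x y
    simp [τ]
  have hτ : τ.IsSymmetric := by
    intro x y
    rw [hτi, hsymm, real_inner_comm, ← hτi, real_inner_comm]
  set m := Module.finrank ℝ U with hm
  let e := hτ.eigenvectorBasis hm.symm
  let s : Fin m → ℝ := hτ.eigenvalues hm.symm
  have hse : ∀ j k, inner ℝ (e j : H) (σ (e k)) = if j = k then s j else 0 := by
    intro j k
    rw [real_inner_comm, ← hτi, hτ.apply_eigenvectorBasis, inner_smul_left,
      orthonormal_iff_ite.mp e.orthonormal k j]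
    simp only [eq_comm (a := k)]
    split_ifs with h
    · subst h; simp [s]
    · simp
  have hs0 : ∀ k, 0 ≤ s k := by
    intro k
    have := hpos (e k)
    rwa [hse, if_pos rfl] at this
  have hvv : inner ℝ v v ≠ (0 : ℝ) := inner_self_ne_zero.mpr hv
  set w₀ : H := (inner ℝ v v)⁻¹ • v with hw₀
  have hve : ∀ u : U, inner ℝ v (u : H) = 0 := fun u =>
    (Submodule.mem_orthogonal_singleton_iff_inner_right.mp u.2)
  have hvw₀ : inner ℝ v w₀ = 1 := by
    rw [hw₀, inner_smul_right, inv_mul_cancel₀ hvv]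
  let t : Fin m → ℝ := fun k => inner ℝ w₀ (σ (e k))
  -- A null direction of a positive form has no cross terms; otherwise the form, affine in `r` along
  -- `w₀ + r • e k`, would become negative. This makes the convention `t k ^ 2 / 0 = 0` below the
  -- correct value.
  have ht0 : ∀ k, s k = 0 → t k = 0 := by
    intro k hk
    by_contra htk
    set A := inner ℝ w₀ (σ w₀)
    have hq : ∀ r : ℝ, 0 ≤ A + 2 * r * t k := by
      intro r
      have := hpos (w₀ + r • (e k : H))
      have h2 : inner ℝ (e k : H) (σ w₀) = t k := by rw [real_inner_comm, hsymm]
      simp only [map_add, map_smul, inner_add_left, inner_add_right, inner_smul_left,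
        inner_smul_right, hse, if_pos, hk, h2] at this
      simp only [conj_trivial] at this
      change 0 ≤ A + r * t k + r * (t k + r * 0) at this
      linarith
    have h3 := hq (-(A + 1) / (2 * t k))
    have : 2 * (-(A + 1) / (2 * t k)) * t k = -(A + 1) := by field_simp
    linarith
  have hexp : ∀ y : Fin m → ℝ, ‖w₀ + ∑ k, y k • (e k : H)‖ ^ 2 = ‖w₀‖ ^ 2 + ∑ k, y k ^ 2 := by
    intro y
    have h1 : inner ℝ w₀ (∑ k, y k • (e k : H)) = 0 := by
      simp [inner_sum, inner_smul_right, hw₀, inner_smul_left, hve]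
    have h2 : (∑ k, y k • (e k : H)) = ((∑ k, y k • e k : U) : H) := by simp
    rw [norm_add_sq_real, h1, h2, ← Submodule.coe_norm,
      ← real_inner_self_eq_norm_sq (F := U), e.orthonormal.inner_sum]
    simp [sq]
  have hexpσ : ∀ y : Fin m → ℝ, inner ℝ (w₀ + ∑ k, y k • (e k : H))
      (σ (w₀ + ∑ k, y k • (e k : H))) =
      inner ℝ w₀ (σ w₀) + 2 * ∑ k, t k * y k + ∑ k, s k * y k ^ 2 := by
    intro y
    have h2 : ∀ k, inner ℝ (e k : H) (σ w₀) = t k := fun k => by rw [real_inner_comm, hsymm]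
    simp only [map_add, map_sum, map_smul, inner_add_left, inner_add_right, inner_sum, sum_inner,
      inner_smul_left, inner_smul_right, hse, h2]
    have h3 : ∀ k, inner ℝ w₀ (σ (e k)) = t k := fun k => rfl
    simp only [h3, conj_trivial, mul_ite, mul_zero, Finset.sum_ite_eq', Finset.mem_univ, if_true,
      mul_add, Finset.sum_add_distrib, Finset.mul_sum, add_assoc, add_right_inj]
    rw [← add_assoc, ← Finset.sum_add_distrib]
    congr 1 <;> exact Finset.sum_congr rfl fun k _ => by ring
  have hall : ∀ w : H, inner ℝ v w = 1 → ∃ y : Fin m → ℝ, w = w₀ + ∑ k, y k • (e k : H) := by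
    intro w hw
    have hmem : w - w₀ ∈ U := by
      rw [hU, Submodule.mem_orthogonal_singleton_iff_inner_right, inner_sub_right, hw, hvw₀, sub_self]
    refine ⟨fun k => inner ℝ (e k) (⟨w - w₀, hmem⟩ : U), ?_⟩
    have := congrArg (Subtype.val) (e.sum_repr' ⟨w - w₀, hmem⟩)
    simp only [Submodule.coe_sum, Submodule.coe_smul] at this
    rw [this, add_sub_cancel]
  set c₁ := inner ℝ w₀ (σ w₀) - ∑ k, t k ^ 2 / s k with hc₁
  -- Completing the square in each coordinate; only the last sum depends on `y`.
  have hid : ∀ z : ℝ, 0 ≤ z → ∀ y : Fin m → ℝ,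
      ‖w₀ + ∑ k, y k • (e k : H)‖ ^ 2 + z * inner ℝ (w₀ + ∑ k, y k • (e k : H))
        (σ (w₀ + ∑ k, y k • (e k : H))) =
      ‖w₀‖ ^ 2 + c₁ * z + ∑ k, t k ^ 2 / s k * (z / (1 + s k * z)) +
        ∑ k, (1 + z * s k) * (y k + z * t k / (1 + z * s k)) ^ 2 := by
    intro z hz y
    rw [hexp, hexpσ, hc₁]
    have key : ∀ k, y k ^ 2 + z * (2 * (t k * y k) + s k * y k ^ 2) =
        -(t k ^ 2 / s k) * z + t k ^ 2 / s k * (z / (1 + s k * z)) +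
        (1 + z * s k) * (y k + z * t k / (1 + z * s k)) ^ 2 := by
      intro k
      by_cases hk : s k = 0
      · rw [ht0 k hk, hk]; simp
      · have : 1 + z * s k ≠ 0 := by have := mul_nonneg hz (hs0 k); positivity
        have : 1 + s k * z ≠ 0 := by rwa [mul_comm]
        field_simp
        ring
    have := Finset.sum_congr (s₁ := Finset.univ) rfl (fun k _ => key k)
    simp only [Finset.sum_add_distrib, ← Finset.mul_sum, ← Finset.sum_mul, Finset.sum_neg_distrib]
      at this
    linarith
  refine ⟨m, ‖w₀‖ ^ 2, c₁, fun k => t k ^ 2 / s k, s, ?_,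
    fun k => div_nonneg (sq_nonneg _) (hs0 k), hs0, ?_, ?_⟩
  -- `c₁` is the value of the form `σ` at this point of the hyperplane, where it is smallest.
  · have h1 := hpos (w₀ + ∑ k, (-(t k / s k)) • (e k : H))
    rw [hexpσ] at h1
    have key : ∀ k, t k * -(t k / s k) = -(t k ^ 2 / s k) ∧
        s k * (-(t k / s k)) ^ 2 = t k ^ 2 / s k := by
      intro k
      by_cases hk : s k = 0
      · simp [hk]
      · constructor <;> field_simp
    simp only [(key _).1, (key _).2, Finset.sum_neg_distrib] at h1
    rw [hc₁]
    linarith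
  · intro z hz
    refine ⟨w₀ + ∑ k, (-(z * t k / (1 + z * s k))) • (e k : H), ?_, ?_⟩
    · rw [inner_add_right, hvw₀]
      simp [inner_sum, inner_smul_right, hve]
    · rw [hid z hz]
      simp
  · intro z hz w hw
    obtain ⟨y, rfl⟩ := hall w hw
    rw [hid z hz]
    have : 0 ≤ ∑ k, (1 + z * s k) * (y k + z * t k / (1 + z * s k)) ^ 2 :=
      Finset.sum_nonneg fun k _ => mul_nonneg (by have := mul_nonneg hz (hs0 k); positivity)
        (sq_nonneg _)
    linarith

theorem Matrix.PosDef.exists_transpose_mul_self {κ : Type*} [Fintype κ] [DecidableEq κ]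
    {ρ : Matrix κ κ ℝ} (hρ : ρ.PosDef) : ∃ B : Matrix κ κ ℝ, IsUnit B.det ∧ ρ = B.transpose * B := by
  have h : ∃ B : Matrix κ κ ℝ, ρ = B.transpose * B := by
    obtain ⟨X, hX, -, h⟩ := CFC.exists_sqrt_of_isSelfAdjoint_of_quasispectrumRestricts
      (a := ρ) hρ.1 (QuasispectrumRestricts.nnreal_of_nonneg hρ.posSemidef.nonneg)
    refine ⟨X, ?_⟩
    have : X.transpose = X := by
      have := hX.star_eq
      rwa [Matrix.star_eq_conjTranspose, Matrix.conjTranspose_eq_transpose_of_trivial] at this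
    rw [this, ← h]
  obtain ⟨B, rfl⟩ := h
  refine ⟨B, ?_, rfl⟩
  have := hρ.det_pos
  rw [Matrix.det_mul, Matrix.det_transpose] at this
  exact isUnit_iff_ne_zero.mpr fun h => by simp [h] at this

/-- Writing `ρ = BᵀB` and substituting `u = B w` turns `ρ` into the identity, so the Hilbert space
version applies. -/
theorem Matrix.PosDef.exists_hyperplane_min {κ : Type*} [Fintype κ] [DecidableEq κ]
    {ρ σ : Matrix κ κ ℝ} (hρ : ρ.PosDef) (hσ : σ.PosSemidef) (v : κ → ℝ) (hv : v ≠ 0) :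
    ∃ (m : ℕ) (c₀ c₁ : ℝ) (d s : Fin m → ℝ), 0 ≤ c₁ ∧ (∀ k, 0 ≤ d k) ∧ (∀ k, 0 ≤ s k) ∧
      (∀ z : ℝ, 0 ≤ z → ∃ w : κ → ℝ, v ⬝ᵥ w = 1 ∧
        w ⬝ᵥ ρ *ᵥ w + z * (w ⬝ᵥ σ *ᵥ w) = c₀ + c₁ * z + ∑ k, d k * (z / (1 + s k * z))) ∧
      (∀ z : ℝ, 0 ≤ z → ∀ w : κ → ℝ, v ⬝ᵥ w = 1 →
        c₀ + c₁ * z + ∑ k, d k * (z / (1 + s k * z)) ≤ w ⬝ᵥ ρ *ᵥ w + z * (w ⬝ᵥ σ *ᵥ w)) := by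
  obtain ⟨B, hB, rfl⟩ := hρ.exists_transpose_mul_self
  have hσ' : (B⁻¹.transpose * σ * B⁻¹).PosSemidef := by
    have := hσ.conjTranspose_mul_mul_same B⁻¹
    rwa [Matrix.conjTranspose_eq_transpose_of_trivial] at this
  have hBB : B⁻¹ * B = 1 := Matrix.nonsing_inv_mul B hB
  have hBB' : B * B⁻¹ = 1 := Matrix.mul_nonsing_inv B hB
  have hv' : WithLp.toLp 2 (B⁻¹.transpose *ᵥ v) ≠ 0 := by
    intro h
    apply hv
    have h1 : B⁻¹.transpose *ᵥ v = 0 := congrArg WithLp.ofLp h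
    have := congrArg (fun u => B.transpose *ᵥ u) h1
    simpa [Matrix.mulVec_mulVec, ← Matrix.transpose_mul, hBB] using this
  obtain ⟨m, c₀, c₁, d, s, hc₁, hd, hs, hatt, hmin⟩ := _root_.exists_hyperplane_min
    (Matrix.toEuclideanLin (B⁻¹.transpose * σ * B⁻¹))
    (Matrix.isPositive_toEuclideanLin_iff.mpr hσ') _ hv'
  have hin : ∀ u : κ → ℝ, inner ℝ (WithLp.toLp 2 (B⁻¹.transpose *ᵥ v)) (WithLp.toLp 2 u) =
      v ⬝ᵥ B⁻¹ *ᵥ u := by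
    intro u
    rw [EuclideanSpace.inner_toLp_toLp, star_trivial, dotProduct_comm, Matrix.mulVec_transpose,
      Matrix.dotProduct_mulVec]
  have hnorm : ∀ u : κ → ℝ, ‖WithLp.toLp 2 u‖ ^ 2 =
      (B⁻¹ *ᵥ u) ⬝ᵥ (B.transpose * B) *ᵥ (B⁻¹ *ᵥ u) := by
    intro u
    rw [← real_inner_self_eq_norm_sq, EuclideanSpace.inner_toLp_toLp, star_trivial,
      ← Matrix.mulVec_mulVec, Matrix.mulVec_mulVec _ B, hBB', Matrix.one_mulVec,
      Matrix.dotProduct_mulVec, Matrix.vecMul_transpose, Matrix.mulVec_mulVec _ B, hBB',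
      Matrix.one_mulVec]
  have hquad : ∀ u : κ → ℝ, inner ℝ (WithLp.toLp 2 u) (Matrix.toEuclideanLin
      (B⁻¹.transpose * σ * B⁻¹) (WithLp.toLp 2 u)) = (B⁻¹ *ᵥ u) ⬝ᵥ σ *ᵥ (B⁻¹ *ᵥ u) := by
    intro u
    rw [Matrix.toLpLin_toLp, EuclideanSpace.inner_toLp_toLp, star_trivial, dotProduct_comm,
      Matrix.toLin'_apply, Matrix.mul_assoc,
      ← Matrix.mulVec_mulVec, Matrix.dotProduct_mulVec, Matrix.vecMul_transpose,
      ← Matrix.mulVec_mulVec]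
  refine ⟨m, c₀, c₁, d, s, hc₁, hd, hs, fun z hz => ?_, fun z hz w hw => ?_⟩
  · obtain ⟨w, hw, h⟩ := hatt z hz
    obtain ⟨u, rfl⟩ : ∃ u, w = WithLp.toLp 2 u := ⟨w.ofLp, rfl⟩
    rw [hin] at hw
    rw [hnorm, hquad] at h
    exact ⟨_, hw, h⟩
  · have hwB : B⁻¹ *ᵥ (B *ᵥ w) = w := by rw [Matrix.mulVec_mulVec, hBB, Matrix.one_mulVec]
    have := hmin z hz (WithLp.toLp 2 (B *ᵥ w)) (by rw [hin, hwB, hw])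
    rwa [hnorm, hquad, hwB] at this

/-! ### Interpolation theorem by convex duality -/

section Contraction

variable {ι κ : Type*} [Fintype ι] [Fintype κ]

/-- The left side separates over the rows of `C`. Row `i` is taken to be `x i • w i` with `w i` the
minimizer of `ρ + α i σ` on `y ⬝ᵥ w = 1`. The minimum `φ(α i)` is a combination of the test
functions, so `∑ x² φ(α) ≤ ∑ y² φ(β)`, where equal total weight takes care of the constant term. The
right side bounds `∑ y² φ(β)` by evaluation at a trial vector. -/
theorem exists_le_trace [DecidableEq κ] {x : ι → ℝ} {y : κ → ℝ} {α : ι → ℝ} {β : κ → ℝ}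
    [Nonempty κ]
    (hy : ∀ j, 0 < y j) (hα : ∀ i, 0 ≤ α i) (hβ : ∀ j, 0 ≤ β j)
    (hsum : ∑ i, x i ^ 2 = ∑ j, y j ^ 2)
    (hle : ∀ s : ℝ, 0 ≤ s → ∑ i, x i ^ 2 * (α i / (1 + s * α i)) ≤
      ∑ j, y j ^ 2 * (β j / (1 + s * β j)))
    {ρ σ : Matrix κ κ ℝ} (hρ : ρ.PosDef) (hσ : σ.PosSemidef) :
    ∃ C : Matrix ι κ ℝ, C *ᵥ y = x ∧
      ∑ i, (C i ⬝ᵥ ρ *ᵥ C i + α i * (C i ⬝ᵥ σ *ᵥ C i)) ≤ ∑ j, (ρ j j + β j * σ j j) := by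
  have hy0 : y ≠ 0 := fun h => (hy (Classical.arbitrary κ)).ne' (congrFun h _)
  obtain ⟨m, c₀, c₁, d, s, hc₁, hd, hs, hatt, hmin⟩ := hρ.exists_hyperplane_min hσ y hy0
  choose w hw hwq using fun i => hatt (α i) (hα i)
  refine ⟨fun i => x i • w i, ?_, ?_⟩
  · ext i
    change (x i • w i) ⬝ᵥ y = x i
    rw [smul_dotProduct, dotProduct_comm, hw, smul_eq_mul, mul_one]
  have hrow : ∀ i, ((x i • w i) ⬝ᵥ ρ *ᵥ (x i • w i) + α i * ((x i • w i) ⬝ᵥ σ *ᵥ (x i • w i))) =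
      c₀ * x i ^ 2 + c₁ * (x i ^ 2 * (α i / (1 + 0 * α i))) +
        ∑ k, d k * (x i ^ 2 * (α i / (1 + s k * α i))) := by
    intro i
    have : ∑ k, d k * (x i ^ 2 * (α i / (1 + s k * α i))) =
        x i ^ 2 * ∑ k, d k * (α i / (1 + s k * α i)) := by
      rw [Finset.mul_sum]
      exact Finset.sum_congr rfl fun k _ => by ring
    rw [this]
    simp only [Matrix.mulVec_smul, smul_dotProduct, dotProduct_smul, smul_eq_mul]
    linear_combination x i ^ 2 * hwq i
  have hcol : ∀ j, c₀ * y j ^ 2 + c₁ * (y j ^ 2 * (β j / (1 + 0 * β j))) +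
        ∑ k, d k * (y j ^ 2 * (β j / (1 + s k * β j))) ≤ ρ j j + β j * σ j j := by
    intro j
    -- The trial vector is the multiple of the `j`th basis vector that lies on the hyperplane.
    have h := hmin (β j) (hβ j) (Pi.single j (y j)⁻¹) (by simp [(hy j).ne'])
    simp only [Matrix.mulVec_single, dotProduct_smul, single_dotProduct] at h
    have : ∑ k, d k * (y j ^ 2 * (β j / (1 + s k * β j))) =
        y j ^ 2 * ∑ k, d k * (β j / (1 + s k * β j)) := by
      rw [Finset.mul_sum]
      exact Finset.sum_congr rfl fun k _ => by ring
    rw [this]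
    have hyj := (hy j).ne'
    have h2 := mul_le_mul_of_nonneg_left h (sq_nonneg (y j))
    simp only [MulOpposite.smul_eq_mul_unop, MulOpposite.unop_op, Matrix.col_apply] at h2
    have e : y j ^ 2 * ((y j)⁻¹ * ρ j j * (y j)⁻¹ + β j * ((y j)⁻¹ * σ j j * (y j)⁻¹)) =
      ρ j j + β j * σ j j := by field_simp
    rw [e] at h2
    simp only [zero_mul, add_zero, div_one]
    linarith
  calc _ = c₀ * ∑ i, x i ^ 2 + c₁ * ∑ i, x i ^ 2 * (α i / (1 + 0 * α i)) +
        ∑ k, d k * ∑ i, x i ^ 2 * (α i / (1 + s k * α i)) := by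
        simp only [hrow, Finset.sum_add_distrib, Finset.mul_sum]
        rw [Finset.sum_comm (γ := Fin m)]
    _ ≤ c₀ * ∑ j, y j ^ 2 + c₁ * ∑ j, y j ^ 2 * (β j / (1 + 0 * β j)) +
        ∑ k, d k * ∑ j, y j ^ 2 * (β j / (1 + s k * β j)) := by
        rw [hsum]
        gcongr with k
        · exact hle 0 le_rfl
        · exact hd k
        · exact hle _ (hs k)
    _ = ∑ j, (c₀ * y j ^ 2 + c₁ * (y j ^ 2 * (β j / (1 + 0 * β j))) +
        ∑ k, d k * (y j ^ 2 * (β j / (1 + s k * β j)))) := by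
        simp only [Finset.sum_add_distrib, Finset.mul_sum]
        rw [Finset.sum_comm (γ := Fin m)]
    _ ≤ _ := Finset.sum_le_sum fun j _ => hcol j

/-- Pairs of bilinear forms that dominate `CᵀC - 1` and `CᵀAC - B` for some `C` with `C y = x`,
where `A` and `B` are diagonal. -/
def dominatingForms (x : ι → ℝ) (y : κ → ℝ) (α : ι → ℝ) (β : κ → ℝ) :
    Set ((κ → κ → ℝ) × (κ → κ → ℝ)) :=
  {M | ∃ C : ι → κ → ℝ, (∀ i, C i ⬝ᵥ y = x i) ∧
    (∀ u : κ → ℝ, ∑ i, (C i ⬝ᵥ u) ^ 2 - ∑ j, u j ^ 2 ≤ ∑ j, ∑ k, M.1 j k * (u j * u k)) ∧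
    (∀ u : κ → ℝ, ∑ i, α i * (C i ⬝ᵥ u) ^ 2 - ∑ j, β j * u j ^ 2 ≤
      ∑ j, ∑ k, M.2 j k * (u j * u k))}

theorem convex_dominatingForms (x : ι → ℝ) (y : κ → ℝ) {α : ι → ℝ} (hα : ∀ i, 0 ≤ α i)
    (β : κ → ℝ) : Convex ℝ (dominatingForms x y α β) := by
  rintro M ⟨C, hC, h1, h2⟩ N ⟨D, hD, h3, h4⟩ a b ha hb hab
  have hcomb : ∀ i (u : κ → ℝ), (a • C i + b • D i) ⬝ᵥ u = a * (C i ⬝ᵥ u) + b * (D i ⬝ᵥ u) := by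
    intro i u
    simp [add_dotProduct]
  have hsq : ∀ s t : ℝ, (a * s + b * t) ^ 2 ≤ a * s ^ 2 + b * t ^ 2 := by
    intro s t
    obtain rfl : b = 1 - a := by linarith
    nlinarith [mul_nonneg (mul_nonneg ha hb) (sq_nonneg (s - t))]
  have hform : ∀ (P Q : κ → κ → ℝ) (u : κ → ℝ),
      ∑ j, ∑ k, (a • P + b • Q) j k * (u j * u k) =
      a * ∑ j, ∑ k, P j k * (u j * u k) + b * ∑ j, ∑ k, Q j k * (u j * u k) := by
    intro P Q u
    simp only [Finset.mul_sum, ← Finset.sum_add_distrib]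
    refine Finset.sum_congr rfl fun j _ => Finset.sum_congr rfl fun k _ => ?_
    simp only [Pi.add_apply, Pi.smul_apply, smul_eq_mul]
    ring
  refine ⟨fun i => a • C i + b • D i, fun i => ?_, fun u => ?_, fun u => ?_⟩
  · rw [hcomb, hC, hD, ← add_mul, hab, one_mul]
  · simp only [hcomb, Prod.fst_add, Prod.smul_fst, hform]
    have : ∑ i, (a * (C i ⬝ᵥ u) + b * (D i ⬝ᵥ u)) ^ 2 ≤
        a * ∑ i, (C i ⬝ᵥ u) ^ 2 + b * ∑ i, (D i ⬝ᵥ u) ^ 2 := by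
      simp only [Finset.mul_sum, ← Finset.sum_add_distrib]
      exact Finset.sum_le_sum fun i _ => hsq _ _
    have e : ∑ j, u j ^ 2 = a * ∑ j, u j ^ 2 + b * ∑ j, u j ^ 2 := by rw [← add_mul, hab, one_mul]
    have := mul_le_mul_of_nonneg_left (h1 u) ha
    have := mul_le_mul_of_nonneg_left (h3 u) hb
    linarith
  · simp only [hcomb, Prod.snd_add, Prod.smul_snd, hform]
    have : ∑ i, α i * (a * (C i ⬝ᵥ u) + b * (D i ⬝ᵥ u)) ^ 2 ≤
        a * ∑ i, α i * (C i ⬝ᵥ u) ^ 2 + b * ∑ i, α i * (D i ⬝ᵥ u) ^ 2 := by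
      simp only [Finset.mul_sum, ← Finset.sum_add_distrib]
      exact Finset.sum_le_sum fun i _ => by
        have := mul_le_mul_of_nonneg_left (hsq (C i ⬝ᵥ u) (D i ⬝ᵥ u)) (hα i)
        linarith
    have e : ∑ j, β j * u j ^ 2 = a * ∑ j, β j * u j ^ 2 + b * ∑ j, β j * u j ^ 2 := by
      rw [← add_mul, hab, one_mul]
    have := mul_le_mul_of_nonneg_left (h2 u) ha
    have := mul_le_mul_of_nonneg_left (h4 u) hb
    linarith

/-- A diagonal entry of the first form, plus one, bounds the sum of squares of a column of `C`.
Hence the witnesses along a convergent sequence are bounded and a subsequence converges. -/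
theorem isClosed_dominatingForms (x : ι → ℝ) (y : κ → ℝ) (α : ι → ℝ) (β : κ → ℝ) :
    IsClosed (dominatingForms x y α β) := by
  classical
  refine IsSeqClosed.isClosed fun M N hM hMN => ?_
  choose C hC h1 h2 using hM
  obtain ⟨R, hR⟩ := (Metric.isBounded_range_of_tendsto M hMN).exists_norm_le
  have hbound : ∀ n, C n ∈ Metric.closedBall (0 : ι → κ → ℝ) (1 + R) := by
    intro n
    have hMn : ‖M n‖ ≤ R := hR _ ⟨n, rfl⟩
    have hR0 : 0 ≤ R := (norm_nonneg _).trans hMn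
    rw [mem_closedBall_zero_iff, pi_norm_le_iff_of_nonneg (by positivity)]
    intro i
    rw [pi_norm_le_iff_of_nonneg (by positivity)]
    intro j
    have hj := h1 n (Pi.single j 1)
    simp [Pi.single_apply] at hj
    have hle : C n i j ^ 2 ≤ ∑ i, C n i j ^ 2 :=
      Finset.single_le_sum (f := fun i => C n i j ^ 2) (fun i _ => sq_nonneg _) (Finset.mem_univ i)
    have hMj : (M n).1 j j ≤ R :=
      (le_abs_self _).trans (((norm_le_pi_norm ((M n).1 j) j).trans (norm_le_pi_norm _ j)).trans
        ((norm_fst_le _).trans hMn))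
    rw [Real.norm_eq_abs]
    refine abs_le_of_sq_le_sq ?_ (by positivity)
    nlinarith
  obtain ⟨D, -, φ, hφ, hD⟩ := tendsto_subseq_of_bounded Metric.isBounded_closedBall hbound
  have hMφ := hMN.comp hφ.tendsto_atTop
  have hCe : ∀ i j, Filter.Tendsto (fun n => C (φ n) i j) Filter.atTop (nhds (D i j)) :=
    fun i j => tendsto_pi_nhds.mp (tendsto_pi_nhds.mp hD i) j
  have hCu : ∀ i (u : κ → ℝ), Filter.Tendsto (fun n => C (φ n) i ⬝ᵥ u) Filter.atTop
      (nhds (D i ⬝ᵥ u)) :=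
    fun i u => tendsto_finsetSum _ fun j _ => (hCe i j).mul_const _
  have hM1 : ∀ j k, Filter.Tendsto (fun n => (M (φ n)).1 j k) Filter.atTop (nhds (N.1 j k)) :=
    fun j k => tendsto_pi_nhds.mp (tendsto_pi_nhds.mp ((continuous_fst.tendsto N).comp hMφ) j) k
  have hM2 : ∀ j k, Filter.Tendsto (fun n => (M (φ n)).2 j k) Filter.atTop (nhds (N.2 j k)) :=
    fun j k => tendsto_pi_nhds.mp (tendsto_pi_nhds.mp ((continuous_snd.tendsto N).comp hMφ) j) k
  refine ⟨D, fun i => ?_, fun u => ?_, fun u => ?_⟩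
  · exact tendsto_nhds_unique (hCu i y) (by simp [hC])
  · exact le_of_tendsto_of_tendsto'
      ((tendsto_finsetSum _ fun i _ => (hCu i u).pow 2).sub_const _)
      (tendsto_finsetSum _ fun j _ => tendsto_finsetSum _ fun k _ => (hM1 j k).mul_const _)
      fun n => h1 _ u
  · exact le_of_tendsto_of_tendsto'
      ((tendsto_finsetSum _ fun i _ => ((hCu i u).pow 2).const_mul _).sub_const _)
      (tendsto_finsetSum _ fun j _ => tendsto_finsetSum _ fun k _ => (hM2 j k).mul_const _)
      fun n => h2 _ u

theorem linearMap_apply_eq_sum [DecidableEq κ] (f : (κ → κ → ℝ) →ₗ[ℝ] ℝ) (M : κ → κ → ℝ) :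
    f M = ∑ j, ∑ k, M j k * f (Pi.single j (Pi.single k 1)) := by
  have h : M = ∑ j, ∑ k, M j k • Pi.single j (Pi.single k (1 : ℝ)) := by
    ext a b
    simp only [Finset.sum_apply, Pi.smul_apply, smul_eq_mul]
    rw [Finset.sum_eq_single a (fun j _ hj => by simp [Pi.single_eq_of_ne' hj]) (by simp),
      Finset.sum_eq_single b (fun j _ hj => by simp [Pi.single_eq_of_ne' hj]) (by simp)]
    simp
  conv_lhs => rw [h]
  simp only [map_sum, map_smul, smul_eq_mul]

/-- Self-duality of the positive semidefinite cone. Symmetry holds because the difference of two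
transposed matrix units has zero quadratic form; positivity comes from testing `f` on rank-one
forms. -/
theorem posSemidef_of_nonneg [DecidableEq κ] (f : (κ → κ → ℝ) →ₗ[ℝ] ℝ)
    (hf : ∀ M : κ → κ → ℝ, (∀ u : κ → ℝ, 0 ≤ ∑ j, ∑ k, M j k * (u j * u k)) → 0 ≤ f M) :
    (Matrix.of fun j k => f (Pi.single j (Pi.single k 1))).PosSemidef := by
  have hsw : ∀ j k (u : κ → ℝ), ∑ a, ∑ b, (Pi.single j (Pi.single k (1 : ℝ)) : κ → κ → ℝ) a b *
      (u a * u b) = u j * u k := by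
    intro j k u
    rw [Finset.sum_eq_single j (fun a _ ha => by simp [Pi.single_eq_of_ne ha]) (by simp),
      Finset.sum_eq_single k (fun a _ ha => by simp [Pi.single_eq_of_ne ha]) (by simp)]
    simp
  have hle : ∀ j k, f (Pi.single j (Pi.single k 1)) ≤ f (Pi.single k (Pi.single j 1)) := by
    intro j k
    have := hf (Pi.single k (Pi.single j 1) - Pi.single j (Pi.single k 1)) fun u => by
      simp only [Pi.sub_apply, sub_mul, Finset.sum_sub_distrib, hsw]
      exact le_of_eq (by ring)
    rwa [map_sub, sub_nonneg] at this
  refine Matrix.PosSemidef.of_dotProduct_mulVec_nonneg ?_ fun u => ?_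
  · ext j k
    simp [le_antisymm (hle j k) (hle k j)]
  · have := hf (fun j k => u j * u k) fun w => by
      have : ∑ j, ∑ k, u j * u k * (w j * w k) = (∑ j, u j * w j) ^ 2 := by
        rw [sq, Finset.sum_mul_sum]
        exact Finset.sum_congr rfl fun j _ => Finset.sum_congr rfl fun k _ => by ring
      rw [this]
      positivity
    rw [linearMap_apply_eq_sum] at this
    simp only [star_trivial, dotProduct, Matrix.mulVec, Matrix.of_apply, Finset.mul_sum]
    refine this.trans_eq (Finset.sum_congr rfl fun j _ => Finset.sum_congr rfl fun k _ => ?_)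
    ring

theorem sum_rank_one_sub_diagonal_mul [DecidableEq κ] (C : ι → κ → ℝ) (a : ι → ℝ) (b : κ → ℝ)
    (r : Matrix κ κ ℝ) :
    ∑ j, ∑ k, (∑ i, a i * (C i j * C i k) - if j = k then b j else 0) * r j k =
      ∑ i, a i * (C i ⬝ᵥ r *ᵥ C i) - ∑ j, b j * r j j := by
  simp only [sub_mul, Finset.sum_sub_distrib, ite_mul, zero_mul, Finset.sum_ite_eq,
    Finset.mem_univ, if_true, sub_left_inj, dotProduct, Matrix.mulVec, Finset.mul_sum,
    Finset.sum_mul]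
  symm
  rw [Finset.sum_comm]
  refine Finset.sum_congr rfl fun j _ => ?_
  rw [Finset.sum_comm]
  exact Finset.sum_congr rfl fun k _ => Finset.sum_congr rfl fun i _ => by ring

/-- A finite-dimensional interpolation theorem: the hypotheses say that the quadratic
`K`-functionals of `x` are bounded by those of `y`. -/
theorem exists_contraction [Nonempty κ] {x : ι → ℝ} {y : κ → ℝ} {α : ι → ℝ} {β : κ → ℝ}
    (hy : ∀ j, 0 < y j) (hα : ∀ i, 0 ≤ α i) (hβ : ∀ j, 0 ≤ β j)
    (hsum : ∑ i, x i ^ 2 = ∑ j, y j ^ 2)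
    (hle : ∀ s : ℝ, 0 ≤ s → ∑ i, x i ^ 2 * (α i / (1 + s * α i)) ≤
      ∑ j, y j ^ 2 * (β j / (1 + s * β j))) :
    ∃ C : ι → κ → ℝ, (∀ i, C i ⬝ᵥ y = x i) ∧
      (∀ u : κ → ℝ, ∑ i, (C i ⬝ᵥ u) ^ 2 ≤ ∑ j, u j ^ 2) ∧
      (∀ u : κ → ℝ, ∑ i, α i * (C i ⬝ᵥ u) ^ 2 ≤ ∑ j, β j * u j ^ 2) := by
  classical
  suffices h0 : (0 : (κ → κ → ℝ) × (κ → κ → ℝ)) ∈ dominatingForms x y α β by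
    obtain ⟨C, hC, h1, h2⟩ := h0
    refine ⟨C, hC, fun u => ?_, fun u => ?_⟩
    · simpa using h1 u
    · simpa using h2 u
  by_contra h0
  obtain ⟨f, c, hc, hf⟩ := geometric_hahn_banach_point_closed
    (convex_dominatingForms x y hα β) (isClosed_dominatingForms x y α β) h0
  rw [map_zero] at hc
  set f₁ : (κ → κ → ℝ) →ₗ[ℝ] ℝ := f.toLinearMap ∘ₗ LinearMap.inl ℝ _ _ with hf₁
  set f₂ : (κ → κ → ℝ) →ₗ[ℝ] ℝ := f.toLinearMap ∘ₗ LinearMap.inr ℝ _ _ with hf₂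
  have hsplit : ∀ M N, f (M, N) = f₁ M + f₂ N := by
    intro M N
    simp [hf₁, hf₂, ← map_add]
  -- The smallest pair of forms that `C` dominates with: `CᵀC - 1` and `CᵀAC - B`.
  let tight : (ι → κ → ℝ) → (κ → κ → ℝ) × (κ → κ → ℝ) := fun C =>
    (fun j k => ∑ i, (1 : ι → ℝ) i * (C i j * C i k) - if j = k then (1 : κ → ℝ) j else 0,
     fun j k => ∑ i, α i * (C i j * C i k) - if j = k then β j else 0)
  have htight : ∀ C : ι → κ → ℝ, (∀ i, C i ⬝ᵥ y = x i) → ∀ M N : κ → κ → ℝ,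
      (∀ u : κ → ℝ, 0 ≤ ∑ j, ∑ k, M j k * (u j * u k)) →
      (∀ u : κ → ℝ, 0 ≤ ∑ j, ∑ k, N j k * (u j * u k)) →
      tight C + (M, N) ∈ dominatingForms x y α β := by
    intro C hC M N hM hN
    have hr : ∀ (u : κ → ℝ) i, (C i ⬝ᵥ (Matrix.of fun j k => u j * u k) *ᵥ C i) =
        (C i ⬝ᵥ u) ^ 2 := by
      intro u i
      simp only [dotProduct, Matrix.mulVec, Matrix.of_apply]
      rw [sq, Finset.sum_mul_sum]
      refine Finset.sum_congr rfl fun j _ => ?_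
      rw [Finset.mul_sum]
      exact Finset.sum_congr rfl fun k _ => by ring
    have hform : ∀ (a : ι → ℝ) (b u : κ → ℝ),
        ∑ j, ∑ k, (∑ i, a i * (C i j * C i k) - if j = k then b j else 0) * (u j * u k) =
        ∑ i, a i * (C i ⬝ᵥ u) ^ 2 - ∑ j, b j * u j ^ 2 := by
      intro a b u
      have := sum_rank_one_sub_diagonal_mul C a b (Matrix.of fun j k => u j * u k)
      simpa only [hr, Matrix.of_apply, ← sq] using this
    refine ⟨C, hC, fun u => ?_, fun u => ?_⟩
    · simp only [tight, Prod.fst_add, Pi.add_apply, add_mul, Finset.sum_add_distrib]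
      rw [hform]
      simpa using hM u
    · simp only [tight, Prod.snd_add, Pi.add_apply, add_mul, Finset.sum_add_distrib]
      rw [hform]
      simpa using hN u
  have hval : ∀ C : ι → κ → ℝ, (∀ i, C i ⬝ᵥ y = x i) → c < f (tight C) := by
    intro C hC
    have := htight C hC 0 0 (by simp) (by simp)
    simpa only [← Prod.zero_eq_mk, add_zero] using hf _ this
  have hy0 : 0 < ∑ j, y j ^ 2 := Finset.sum_pos (fun j _ => pow_pos (hy j) 2) Finset.univ_nonempty
  have hcone : ∀ M N : κ → κ → ℝ, (∀ u : κ → ℝ, 0 ≤ ∑ j, ∑ k, M j k * (u j * u k)) →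
      (∀ u : κ → ℝ, 0 ≤ ∑ j, ∑ k, N j k * (u j * u k)) → 0 ≤ f (M, N) := by
    intro M N hM hN
    by_contra! hneg
    -- Any base point with `C y = x` would serve. The functional exceeds `c > 0` along the ray from
    -- it in the direction `(M, N)`, so it cannot be negative in that direction.
    let C : ι → κ → ℝ := fun i j => x i * y j / ∑ j, y j ^ 2
    have hC : ∀ i, C i ⬝ᵥ y = x i := by
      intro i
      have : ∀ j, C i j * y j = x i / (∑ j, y j ^ 2) * y j ^ 2 := fun j => by
        simp only [C]; ring
      simp only [dotProduct, this, ← Finset.mul_sum]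
      field_simp
    have hlim : ∀ t : ℝ, 0 ≤ t → c < f (tight C) + t * f (M, N) := by
      intro t ht
      have hsm : ∀ P : κ → κ → ℝ, (∀ u : κ → ℝ, 0 ≤ ∑ j, ∑ k, P j k * (u j * u k)) →
          ∀ u : κ → ℝ, 0 ≤ ∑ j, ∑ k, (t • P) j k * (u j * u k) := by
        intro P hP u
        have := mul_nonneg ht (hP u)
        simpa only [Pi.smul_apply, smul_eq_mul, mul_assoc, Finset.mul_sum] using this
      have := hf _ (htight C hC (t • M) (t • N) (hsm M hM) (hsm N hN))
      rwa [map_add, ← Prod.smul_mk, map_smul, smul_eq_mul] at this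
    have hC0 := hlim 0 le_rfl
    have h1 := hlim (f (tight C) / -f (M, N)) (div_nonneg (by linarith) (by linarith))
    have : f (tight C) / -f (M, N) * f (M, N) = -f (tight C) := by
      rw [div_neg, neg_mul, div_mul_cancel₀ _ hneg.ne]
    linarith
  set r : Matrix κ κ ℝ := Matrix.of fun j k => f₁ (Pi.single j (Pi.single k 1)) with hr
  set s : Matrix κ κ ℝ := Matrix.of fun j k => f₂ (Pi.single j (Pi.single k 1)) with hs
  have hrpos : r.PosSemidef := posSemidef_of_nonneg f₁ fun M hM => by
    simpa [hsplit] using hcone M 0 hM (by simp)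
  have hspos : s.PosSemidef := posSemidef_of_nonneg f₂ fun M hM => by
    simpa [hsplit] using hcone 0 M (by simp) hM
  have hft : ∀ C : ι → κ → ℝ, f (tight C) = ∑ i, (C i ⬝ᵥ r *ᵥ C i + α i * (C i ⬝ᵥ s *ᵥ C i)) -
      ∑ j, (r j j + β j * s j j) := by
    intro C
    rw [hsplit, linearMap_apply_eq_sum f₁, linearMap_apply_eq_sum f₂]
    have e₁ := sum_rank_one_sub_diagonal_mul C 1 1 r
    have e₂ := sum_rank_one_sub_diagonal_mul C α β s
    simp only [hr, hs, Matrix.of_apply] at e₁ e₂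
    rw [e₁, e₂]
    simp only [Finset.sum_add_distrib, Pi.one_apply, one_mul, hr, hs, Matrix.of_apply]
    ring
  set b : ℝ := (Fintype.card κ : ℝ) with hb
  have hb0 : 0 ≤ b := Nat.cast_nonneg _
  -- `r` may be singular. Adding `δ • 1` makes it positive definite and raises its trace by `δ * b ≤
  -- c`, which does not exceed the separation gap.
  set δ : ℝ := c / (b + 1) with hδ
  have hδ0 : 0 < δ := by positivity
  have hρ : (r + δ • (1 : Matrix κ κ ℝ)).PosDef :=
    Matrix.PosDef.posSemidef_add hrpos (Matrix.PosDef.one.smul hδ0)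
  obtain ⟨C, hC, hCle⟩ := exists_le_trace hy hα hβ hsum hle hρ hspos
  have h1 := (hval C fun i => congrFun hC i).trans_eq (hft C)
  have e1 : ∑ j, ((r + δ • (1 : Matrix κ κ ℝ)) j j + β j * s j j) =
      ∑ j, (r j j + β j * s j j) + δ * b := by
    simp [Finset.sum_add_distrib, hb]
    ring
  have e2 : ∑ i, (C i ⬝ᵥ r *ᵥ C i + α i * (C i ⬝ᵥ s *ᵥ C i)) ≤
      ∑ i, (C i ⬝ᵥ (r + δ • (1 : Matrix κ κ ℝ)) *ᵥ C i + α i * (C i ⬝ᵥ s *ᵥ C i)) := by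
    refine Finset.sum_le_sum fun i _ => ?_
    have : 0 ≤ δ * (C i ⬝ᵥ C i) := mul_nonneg hδ0.le
      (Finset.sum_nonneg fun j _ => mul_self_nonneg _)
    simp only [Matrix.add_mulVec, Matrix.smul_mulVec, Matrix.one_mulVec, dotProduct_add,
      dotProduct_smul, smul_eq_mul]
    linarith
  have e3 : δ * b ≤ c := by
    rw [hδ, div_mul_eq_mul_div, div_le_iff₀ (by positivity)]
    nlinarith
  linarith

end Contraction

/-! ### Orthonormal families with prescribed overlaps -/

section Gram

variable {ι κ : Type*} [Fintype ι] [Fintype κ]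

/-- The null vector forces a zero eigenvalue, whose coordinate can be dropped from the spectral
factorization; unused coordinates of `Fin n` are filled with zeros. -/
theorem Matrix.PosSemidef.exists_gram [DecidableEq κ] {M : Matrix κ κ ℝ} (hM : M.PosSemidef)
    {u : κ → ℝ} (hu : u ≠ 0) (hMu : u ⬝ᵥ M *ᵥ u = 0) {n : ℕ} (hn : Fintype.card κ ≤ n + 1) :
    ∃ G : κ → Fin n → ℝ, ∀ k k', ∑ l, G k l * G k' l = M k k' := by
  obtain ⟨l₀, hl₀⟩ : ∃ l₀, hM.1.eigenvalues l₀ = 0 := by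
    by_contra! h
    have hpd : M.PosDef := hM.1.posDef_iff_eigenvalues_pos.mpr fun l =>
      lt_of_le_of_ne (hM.eigenvalues_nonneg l) (h l).symm
    have := hpd.dotProduct_mulVec_pos hu
    rw [star_trivial, hMu] at this
    exact lt_irrefl _ this
  have hcard : Fintype.card {l // l ≠ l₀} ≤ Fintype.card (Fin n) := by
    rw [Fintype.card_subtype_compl, Fintype.card_subtype_eq, Fintype.card_fin]
    omega
  obtain ⟨e⟩ := Function.Embedding.nonempty_of_card_le hcard
  obtain ⟨U, hspec⟩ : ∃ U : κ → κ → ℝ,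
      ∀ k k', M k k' = ∑ l, hM.1.eigenvalues l * (U k l * U k' l) := by
    refine ⟨fun k l => hM.1.eigenvectorUnitary.1 k l, fun k k' => ?_⟩
    conv_lhs => rw [hM.1.spectral_theorem, Unitary.conjStarAlgAut_apply]
    rw [Matrix.mul_apply]
    refine Finset.sum_congr rfl fun l _ => ?_
    rw [Matrix.mul_diagonal, Matrix.star_apply, star_trivial]
    simp only [Function.comp_apply, RCLike.ofReal_real_eq_id, id]
    ring
  set μ := hM.1.eigenvalues with hμ
  refine ⟨fun k => Function.extend e (fun l => Real.sqrt (μ l) * U k l) 0, fun k k' => ?_⟩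
  rw [hspec, ← Fintype.sum_of_injective e e.injective
    (fun l => μ l * (U k l * U k' l)) _ (fun i hi => ?_) (fun l => ?_)]
  · refine Fintype.sum_of_injective (fun l : {l // l ≠ l₀} => l.1) Subtype.val_injective _ _
      (fun l hl => ?_) fun l => rfl
    have : l = l₀ := by simpa using hl
    rw [this, hl₀, zero_mul]
  · simp only [Function.extend_apply' _ _ _ hi, Pi.zero_apply, mul_zero]
  · simp only [e.injective.extend_apply]
    rw [mul_mul_mul_comm, Real.mul_self_sqrt (hM.eigenvalues_nonneg _)]

theorem exists_orthonormal_families {C : ι → κ → ℝ} {x : ι → ℝ} {y : κ → ℝ} (hy : y ≠ 0)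
    (hCy : ∀ i, C i ⬝ᵥ y = x i) (hsum : ∑ i, x i ^ 2 = ∑ j, y j ^ 2)
    (hC : ∀ u : κ → ℝ, ∑ i, (C i ⬝ᵥ u) ^ 2 ≤ ∑ j, u j ^ 2) {n : ℕ}
    (hn : Fintype.card ι + Fintype.card κ ≤ n + 1) :
    ∃ (ξ : ι → EuclideanSpace ℂ (Fin n)) (η : κ → EuclideanSpace ℂ (Fin n)),
      Orthonormal ℂ ξ ∧ Orthonormal ℂ η ∧ (∀ i j, inner ℂ (ξ i) (η j) = (C i j : ℂ)) ∧
      ∑ i, (x i : ℂ) • ξ i = ∑ j, (y j : ℂ) • η j := by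
  classical
  set M : Matrix (ι ⊕ κ) (ι ⊕ κ) ℝ := Matrix.fromBlocks 1 (Matrix.of C) (Matrix.of C)ᵀ 1 with hMdef
  have hquad : ∀ (s : ι → ℝ) (t : κ → ℝ), (Sum.elim s t) ⬝ᵥ M *ᵥ (Sum.elim s t) =
      ∑ i, (s i + C i ⬝ᵥ t) ^ 2 + (∑ j, t j ^ 2 - ∑ i, (C i ⬝ᵥ t) ^ 2) := by
    intro s t
    have e₁ : t ⬝ᵥ (Matrix.of C)ᵀ *ᵥ s = ∑ i, s i * (C i ⬝ᵥ t) := by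
      rw [Matrix.mulVec_transpose, dotProduct_comm, ← Matrix.dotProduct_mulVec]
      rfl
    have e₂ : s ⬝ᵥ (Matrix.of C) *ᵥ t = ∑ i, s i * (C i ⬝ᵥ t) := rfl
    rw [hMdef, Matrix.fromBlocks_mulVec, sumElim_dotProduct_sumElim]
    simp only [Sum.elim_comp_inl, Sum.elim_comp_inr, Matrix.one_mulVec, dotProduct_add, e₁, e₂]
    simp only [add_sq, Finset.sum_add_distrib, mul_assoc, ← Finset.mul_sum]
    simp only [dotProduct, ← sq]
    ring
  have hM : M.PosSemidef := by
    refine Matrix.PosSemidef.of_dotProduct_mulVec_nonneg ?_ fun u => ?_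
    · rw [Matrix.IsHermitian, hMdef, Matrix.fromBlocks_conjTranspose]
      simp [Matrix.conjTranspose_eq_transpose_of_trivial]
    · rw [star_trivial, ← Sum.elim_comp_inl_inr u, hquad]
      have := hC (u ∘ Sum.inr)
      have : 0 ≤ ∑ i, ((u ∘ Sum.inl) i + C i ⬝ᵥ (u ∘ Sum.inr)) ^ 2 :=
        Finset.sum_nonneg fun _ _ => sq_nonneg _
      linarith
  have hu : Sum.elim x (-y) ≠ 0 := by
    intro h
    exact hy (funext fun j => by simpa using congrFun h (Sum.inr j))
  have hMu : Sum.elim x (-y) ⬝ᵥ M *ᵥ Sum.elim x (-y) = 0 := by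
    rw [hquad]
    simp [dotProduct_neg, hCy, hsum]
  obtain ⟨G, hG⟩ := hM.exists_gram hu hMu (n := n) (by rwa [Fintype.card_sum])
  let g : ι ⊕ κ → EuclideanSpace ℂ (Fin n) := fun k => WithLp.toLp 2 fun l => (G k l : ℂ)
  have hg : ∀ k k', inner ℂ (g k) (g k') = (M k k' : ℂ) := by
    intro k k'
    rw [← hG]
    simp [g, EuclideanSpace.inner_toLp_toLp, dotProduct, mul_comm]
  -- A null vector of a Gram matrix is a linear relation between the vectors; here it identifies the
  -- two expansions of `ψ`.
  have hker : ∀ l, ∑ i, x i * G (Sum.inl i) l - ∑ j, y j * G (Sum.inr j) l = 0 := by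
    have h1 : ∑ l, (∑ k, Sum.elim x (-y) k * G k l) ^ 2 = 0 := by
      rw [← hMu]
      simp only [dotProduct, Matrix.mulVec, Finset.mul_sum, ← hG, sq, Finset.sum_mul]
      rw [Finset.sum_comm]
      refine Finset.sum_congr rfl fun k _ => ?_
      rw [Finset.sum_comm]
      refine Finset.sum_congr rfl fun k' _ => Finset.sum_congr rfl fun l _ => ?_
      ring
    intro l
    have h2 := (Finset.sum_eq_zero_iff_of_nonneg fun _ _ => sq_nonneg _).mp h1 l
      (Finset.mem_univ l)
    simpa [Fintype.sum_sum_type, sub_eq_add_neg] using h2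
  refine ⟨fun i => g (Sum.inl i), fun j => g (Sum.inr j), ?_, ?_, fun i j => ?_, ?_⟩
  · rw [orthonormal_iff_ite]
    intro i i'
    rw [hg, hMdef, Matrix.fromBlocks_apply₁₁, Matrix.one_apply]
    split_ifs <;> simp
  · rw [orthonormal_iff_ite]
    intro j j'
    rw [hg, hMdef, Matrix.fromBlocks_apply₂₂, Matrix.one_apply]
    split_ifs <;> simp
  · rw [hg, hMdef, Matrix.fromBlocks_apply₁₂, Matrix.of_apply]
  · ext l
    have := sub_eq_zero.mp (hker l)
    simp [g]
    exact_mod_cast this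

end Gram

/-! ### Operator monotone test functions and the choice of `Λ` -/

section TestFunctions

open scoped Matrix.Norms.L2Operator in
theorem operatorMonotone_one_sub_one_add_inv : OperatorMonotone fun x => 1 - (1 + x)⁻¹ := by
  intro n X Y hX hY hXY
  have := CFC.monotoneOn_one_sub_one_add_inv (A := Matrix (Fin n) (Fin n) ℂ) hX.nonneg hY.nonneg hXY
  rw [cfcₙ_eq_cfc, cfcₙ_eq_cfc] at this
  exact this

theorem operatorMonotone_id : OperatorMonotone id := by
  intro n X Y hX hY hXY
  rwa [cfc_id ℝ≥0 X hX.nonneg, cfc_id ℝ≥0 Y hY.nonneg]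

theorem operatorMonotone_div (c : ℝ≥0) : OperatorMonotone fun x => c * x / (1 + c * x) := by
  intro n X Y hX hY hXY
  have e : (fun x : ℝ≥0 => c * x / (1 + c * x)) =
      fun x => (fun x : ℝ≥0 => 1 - (1 + x)⁻¹) (c * x) := by
    funext x
    beta_reduce
    have : (1 + c * x : ℝ≥0) ≠ 0 := by positivity
    rw [eq_tsub_iff_add_eq_of_le (by simp)]
    field_simp
    ring
  have hc : ∀ s : Set ℝ≥0, ContinuousOn (fun x : ℝ≥0 => 1 - (1 + x)⁻¹) s :=
    fun s => by fun_prop (disch := intros; positivity)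
  rw [e, cfc_comp_const_mul c (fun x : ℝ≥0 => 1 - (1 + x)⁻¹) X (hc _) hX.nonneg,
    cfc_comp_const_mul c (fun x : ℝ≥0 => 1 - (1 + x)⁻¹) Y (hc _) hY.nonneg]
  have hs : ∀ Z : Matrix (Fin n) (Fin n) ℂ, c • Z = (c : ℝ) • Z := fun _ => rfl
  rw [hs, hs]
  refine operatorMonotone_one_sub_one_add_inv n _ _ (hX.smul c.2) (hY.smul c.2) ?_
  exact smul_le_smul_of_nonneg_left hXY c.2

theorem StrictlyValidTransition.sum_eq {p q : ℝ≥0 →₀ ℝ≥0} (h : StrictlyValidTransition p q) :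
    ∑ z : p.support, (p z : ℝ) = ∑ z : q.support, (q z : ℝ) := by
  rw [Finset.sum_coe_sort p.support fun z => (p z : ℝ),
    Finset.sum_coe_sort q.support fun z => (q z : ℝ)]
  exact_mod_cast h.1.1

theorem StrictlyValidTransition.sum_mul_lt {p q : ℝ≥0 →₀ ℝ≥0} (h : StrictlyValidTransition p q) :
    ∑ z : p.support, (p z : ℝ) * ((z : ℝ≥0) : ℝ) <
      ∑ z : q.support, (q z : ℝ) * ((z : ℝ≥0) : ℝ) := by
  rw [Finset.sum_coe_sort p.support fun z => (p z : ℝ) * (z : ℝ),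
    Finset.sum_coe_sort q.support fun z => (q z : ℝ) * (z : ℝ)]
  exact_mod_cast h.2 id continuous_id operatorMonotone_id ⟨0, 1, zero_ne_one⟩

theorem StrictlyValidTransition.sum_mul_div_le {p q : ℝ≥0 →₀ ℝ≥0}
    (h : StrictlyValidTransition p q) (c : ℝ) (hc : 0 ≤ c) :
    ∑ z : p.support, (p z : ℝ) * (((z : ℝ≥0) : ℝ) / (1 + c * ((z : ℝ≥0) : ℝ))) ≤
      ∑ z : q.support, (q z : ℝ) * (((z : ℝ≥0) : ℝ) / (1 + c * ((z : ℝ≥0) : ℝ))) := by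
  obtain rfl | hc := hc.eq_or_lt
  · simpa using h.sum_mul_lt.le
  lift c to ℝ≥0 using hc.le
  have hle := h.1.2 _ (by fun_prop (disch := intros; positivity)) (operatorMonotone_div c)
  have hle' : ∑ z ∈ p.support, (p z : ℝ) * (c * z / (1 + c * z)) ≤
      ∑ z ∈ q.support, (q z : ℝ) * (c * z / (1 + c * z)) := by exact_mod_cast hle
  rw [Finset.sum_coe_sort p.support fun z => (p z : ℝ) * ((z : ℝ) / (1 + c * (z : ℝ))),
    Finset.sum_coe_sort q.support fun z => (q z : ℝ) * ((z : ℝ) / (1 + c * (z : ℝ)))]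
  refine le_of_mul_le_mul_left ?_ hc
  rw [Finset.mul_sum, Finset.mul_sum]
  simpa only [mul_div_assoc, mul_left_comm] using hle'

variable {ι κ : Type*} [Fintype ι] [Fintype κ]

/-- Beyond some `Λ`, the inequality for `z` extends to the functions `K z / (K - z)`. -/
theorem exists_cutoff {P : ι → ℝ} {Q : κ → ℝ} {α : ι → ℝ} {β : κ → ℝ} (hP : ∀ i, 0 ≤ P i)
    (hQ : ∀ j, 0 ≤ Q j) (hα : ∀ i, 0 ≤ α i) (hβ : ∀ j, 0 ≤ β j)
    (hlt : ∑ i, P i * α i < ∑ j, Q j * β j) :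
    ∃ Λ : ℝ, 0 < Λ ∧ (∀ i, α i < Λ) ∧ (∀ j, β j < Λ) ∧ ∀ K : ℝ, Λ ≤ K →
      ∑ i, P i * (K * α i / (K - α i)) ≤ ∑ j, Q j * (K * β j / (K - β j)) := by
  set M : ℝ := ∑ i, α i + ∑ j, β j with hM
  have hα0 : 0 ≤ ∑ i, α i := Finset.sum_nonneg fun i _ => hα i
  have hβ0 : 0 ≤ ∑ j, β j := Finset.sum_nonneg fun j _ => hβ j
  have hαM : ∀ i, α i ≤ M := fun i => by
    have := Finset.single_le_sum (fun i _ => hα i) (Finset.mem_univ i)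
    linarith
  have hβM : ∀ j, β j ≤ M := fun j => by
    have := Finset.single_le_sum (fun j _ => hβ j) (Finset.mem_univ j)
    linarith
  set Δ := ∑ j, Q j * β j - ∑ i, P i * α i with hΔ
  have hΔ0 : 0 < Δ := sub_pos.mpr hlt
  have hP0 : 0 ≤ ∑ i, P i := Finset.sum_nonneg fun i _ => hP i
  have hM0 : 0 ≤ M := by positivity
  have hfrac : 0 ≤ (∑ i, P i) * M ^ 2 / Δ := by positivity
  have hsplit : ∀ K z : ℝ, z < K → K * z / (K - z) = z + z ^ 2 / (K - z) := by
    intro K z hz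
    have : K - z ≠ 0 := by linarith
    field_simp
    ring
  -- Since `K z/(K - z) = z + z²/(K - z)`, the left sum grows by at most `(∑ P) M²/(K - M)`. This
  -- `Λ` keeps that below the gap `Δ`, while the right sum can only grow.
  refine ⟨M + (∑ i, P i) * M ^ 2 / Δ + 1, by positivity, fun i => by linarith [hαM i],
    fun j => by linarith [hβM j], fun K hK => ?_⟩
  have hKM : 0 < K - M := by linarith
  have h1 : ∑ i, P i * (K * α i / (K - α i)) ≤ ∑ i, P i * α i + Δ := by
    calc ∑ i, P i * (K * α i / (K - α i)) ≤ ∑ i, (P i * α i + P i * (M ^ 2 / (K - M))) := by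
          refine Finset.sum_le_sum fun i _ => ?_
          rw [hsplit _ _ (by linarith [hαM i]), mul_add]
          have h3 := hαM i
          have h4 := hα i
          have := hP i
          gcongr
      _ = ∑ i, P i * α i + (∑ i, P i) * M ^ 2 / (K - M) := by
          rw [Finset.sum_add_distrib, ← Finset.sum_mul, mul_div_assoc]
      _ ≤ ∑ i, P i * α i + Δ := by
          gcongr
          rw [div_le_iff₀ hKM, ← div_le_iff₀' hΔ0]
          linarith
  have h2 : ∑ j, Q j * β j ≤ ∑ j, Q j * (K * β j / (K - β j)) := by
    refine Finset.sum_le_sum fun j _ => mul_le_mul_of_nonneg_left ?_ (hQ j)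
    rw [hsplit _ _ (by linarith [hβM j])]
    have : 0 ≤ β j ^ 2 / (K - β j) := div_nonneg (sq_nonneg _) (by linarith [hβM j])
    linarith
  linarith

/-- The composite simplifies to `Λ z/(Λ + (s Λ - 1) z)`. The sign of `s Λ - 1` decides which
hypothesis applies, with `c = (s Λ - 1)/Λ` or `K = Λ/(1 - s Λ)`. -/
theorem sum_mul_moebius_le {P : ι → ℝ} {Q : κ → ℝ} {α : ι → ℝ} {β : κ → ℝ} {Λ : ℝ} (hΛ : 0 < Λ)
    (hα : ∀ i, α i < Λ) (hβ : ∀ j, β j < Λ)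
    (hdiv : ∀ c : ℝ, 0 ≤ c → ∑ i, P i * (α i / (1 + c * α i)) ≤ ∑ j, Q j * (β j / (1 + c * β j)))
    (hK : ∀ K : ℝ, Λ ≤ K →
      ∑ i, P i * (K * α i / (K - α i)) ≤ ∑ j, Q j * (K * β j / (K - β j)))
    (s : ℝ) (hs : 0 ≤ s) :
    ∑ i, P i * (Λ * α i / (Λ - α i) / (1 + s * (Λ * α i / (Λ - α i)))) ≤
      ∑ j, Q j * (Λ * β j / (Λ - β j) / (1 + s * (Λ * β j / (Λ - β j)))) := by
  have hg : ∀ z, z < Λ → Λ * z / (Λ - z) / (1 + s * (Λ * z / (Λ - z))) =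
      Λ * z / (Λ + (s * Λ - 1) * z) := by
    intro z hz
    have : Λ - z ≠ 0 := by linarith
    rw [div_div, mul_add, mul_one, mul_left_comm (Λ - z) s, mul_div_cancel₀ _ this]
    congr 1
    ring
  have key : ∀ F : ℝ → ℝ, (∀ z, z < Λ → Λ * z / (Λ + (s * Λ - 1) * z) = F z) →
      ∑ i, P i * F (α i) ≤ ∑ j, Q j * F (β j) →
      ∑ i, P i * (Λ * α i / (Λ - α i) / (1 + s * (Λ * α i / (Λ - α i)))) ≤
      ∑ j, Q j * (Λ * β j / (Λ - β j) / (1 + s * (Λ * β j / (Λ - β j)))) := by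
    intro F hF hle
    rw [Finset.sum_congr rfl fun i _ => congrArg (P i * ·) ((hg _ (hα i)).trans (hF _ (hα i))),
      Finset.sum_congr rfl fun j _ => congrArg (Q j * ·) ((hg _ (hβ j)).trans (hF _ (hβ j)))]
    exact hle
  obtain hr | hr := le_or_gt 1 (s * Λ)
  · have hc : 0 ≤ (s * Λ - 1) / Λ := div_nonneg (by linarith) hΛ.le
    refine key (fun z => z / (1 + (s * Λ - 1) / Λ * z)) (fun z hz => ?_) (hdiv _ hc)
    have : Λ + (s * Λ - 1) * z = Λ * (1 + (s * Λ - 1) / Λ * z) := by field_simp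
    rw [this, mul_div_mul_left _ _ hΛ.ne']
  · have hr' : 0 < 1 - s * Λ := by linarith
    have hΛK : Λ ≤ Λ / (1 - s * Λ) := by
      rw [le_div_iff₀ hr']
      nlinarith [mul_nonneg hs hΛ.le]
    refine key (fun z => Λ / (1 - s * Λ) * z / (Λ / (1 - s * Λ) - z)) (fun z hz => ?_) (hK _ hΛK)
    have e₁ : Λ + (s * Λ - 1) * z = (1 - s * Λ) * (Λ / (1 - s * Λ) - z) := by
      rw [mul_sub, mul_div_cancel₀ _ hr'.ne']
      ring
    have e₂ : Λ * z = (1 - s * Λ) * (Λ / (1 - s * Λ) * z) := by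
      rw [← mul_assoc, mul_div_cancel₀ _ hr'.ne']
    rw [e₁, e₂, mul_div_mul_left _ _ hr'.ne']

end TestFunctions

/-! ### Operators given by an orthonormal family, and their order -/

section SpectralOperator

variable {H : Type*} [NormedAddCommGroup H] [InnerProductSpace ℂ H]
variable {ι κ : Type*} [Fintype ι] [Fintype κ]

/-- The operator with eigenvalue `α i` at `ξ i` and `c` on the orthogonal complement. -/
noncomputable def spectralOperator (c : ℝ) (α : ι → ℝ) (ξ : ι → H) : H →ₗ[ℂ] H :=
  (c : ℂ) • LinearMap.id +
    ∑ i, ((α i - c : ℝ) : ℂ) • ((innerSL ℂ (ξ i)).toLinearMap.smulRight (ξ i))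

theorem spectralOperator_apply (c : ℝ) (α : ι → ℝ) (ξ : ι → H) (v : H) :
    spectralOperator c α ξ v =
      (c : ℂ) • v + ∑ i, ((α i - c : ℝ) : ℂ) • (inner ℂ (ξ i) v • ξ i) := by
  simp [spectralOperator]

theorem spectralOperator_isSymmetric (c : ℝ) (α : ι → ℝ) (ξ : ι → H) :
    (spectralOperator c α ξ).IsSymmetric := by
  intro v w
  simp only [spectralOperator_apply, inner_add_left, inner_add_right, inner_smul_left,
    inner_smul_right, sum_inner, inner_sum, Complex.conj_ofReal, inner_conj_symm]
  congr 1
  exact Finset.sum_congr rfl fun i _ => by ring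

theorem re_inner_spectralOperator (c : ℝ) (α : ι → ℝ) (ξ : ι → H) (v : H) :
    (inner ℂ (spectralOperator c α ξ v) v).re =
      c * ‖v‖ ^ 2 + ∑ i, (α i - c) * ‖inner ℂ (ξ i) v‖ ^ 2 := by
  rw [spectralOperator_apply, inner_add_left, sum_inner, Complex.add_re, Complex.re_sum,
    inner_smul_left, Complex.conj_ofReal, Complex.re_ofReal_mul, inner_self_eq_norm_sq_to_K]
  congr 1
  · norm_cast
  · refine Finset.sum_congr rfl fun i _ => ?_
    rw [inner_smul_left, inner_smul_left, Complex.conj_ofReal, Complex.re_ofReal_mul,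
      ← Complex.normSq_eq_conj_mul_self, Complex.ofReal_re, Complex.normSq_eq_norm_sq]

theorem Orthonormal.spectralOperator_apply_self {ξ : ι → H} (hξ : Orthonormal ℂ ξ) (c : ℝ)
    (α : ι → ℝ) (i : ι) : spectralOperator c α ξ (ξ i) = (α i : ℂ) • ξ i := by
  classical
  rw [spectralOperator_apply, Finset.sum_eq_single i
    (fun k _ hk => by rw [orthonormal_iff_ite.mp hξ, if_neg hk]; simp) (by simp),
    orthonormal_iff_ite.mp hξ, if_pos rfl, one_smul, ← add_smul]
  simp

theorem spectralOperator_apply_of_orthogonal (c : ℝ) (α : ι → ℝ) {ξ : ι → H} {v : H}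
    (hv : ∀ i, inner ℂ (ξ i) v = 0) : spectralOperator c α ξ v = (c : ℂ) • v := by
  simp [spectralOperator_apply, hv]

/-- An eigenvector of a spectral operator for `z ≠ c` is a combination of the `ξ i` with
`α i = z`. -/
theorem Orthonormal.eq_sum_of_spectralOperator_apply_eq {ξ : ι → H} (hξ : Orthonormal ℂ ξ)
    {c : ℝ} {α : ι → ℝ} {z : ℝ} (hz : z ≠ c) {v : H}
    (hv : spectralOperator c α ξ v = (z : ℂ) • v) :
    v = ∑ i, inner ℂ (ξ i) v • ξ i ∧ ∀ i, α i ≠ z → inner ℂ (ξ i) v = 0 := by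
  have hcoef : ∀ i, α i ≠ z → inner ℂ (ξ i) v = 0 := by
    intro i hi
    have h1 := spectralOperator_isSymmetric c α ξ (ξ i) v
    rw [hξ.spectralOperator_apply_self, hv, inner_smul_left, inner_smul_right,
      Complex.conj_ofReal, ← sub_eq_zero, ← sub_mul, mul_eq_zero] at h1
    refine h1.resolve_left fun h => hi ?_
    exact_mod_cast sub_eq_zero.mp h
  refine ⟨?_, hcoef⟩
  have hv' := eq_sub_of_add_eq' ((spectralOperator_apply c α ξ v).symm.trans hv)
  rw [← sub_smul] at hv'
  have hzc : (z : ℂ) - c ≠ 0 := sub_ne_zero.mpr (by exact_mod_cast hz)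
  refine smul_right_injective H hzc ?_
  beta_reduce
  rw [← hv', Finset.smul_sum]
  refine Finset.sum_congr rfl fun i _ => ?_
  by_cases hi : α i = z
  · rw [hi]; push_cast; rfl
  · rw [hcoef i hi]; simp

/-- `C` is real, so the real and imaginary parts of `u` can be treated separately. -/
theorem norm_sum_ofReal_mul_sq_le {C : ι → κ → ℝ} {a : ι → ℝ} {b : κ → ℝ}
    (hC : ∀ u : κ → ℝ, ∑ i, a i * (C i ⬝ᵥ u) ^ 2 ≤ ∑ j, b j * u j ^ 2) (u : κ → ℂ) :
    ∑ i, a i * ‖∑ j, (C i j : ℂ) * u j‖ ^ 2 ≤ ∑ j, b j * ‖u j‖ ^ 2 := by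
  have h1 := hC fun j => (u j).re
  have h2 := hC fun j => (u j).im
  have hsq : ∀ w : ℂ, ‖w‖ ^ 2 = w.re ^ 2 + w.im ^ 2 := fun w => by
    rw [← Complex.normSq_eq_norm_sq, Complex.normSq_apply, sq, sq]
  simp only [hsq, Complex.re_sum, Complex.im_sum, Complex.re_ofReal_mul, Complex.im_ofReal_mul,
    mul_add, Finset.sum_add_distrib]
  exact add_le_add h1 h2

/-- The right side minus the left is `‖α s - (Λ - α) t‖² / (Λ - α)`. -/
theorem mul_norm_add_sq_le {α Λ : ℝ} (hα : α < Λ) (s t : ℂ) :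
    α * ‖s + t‖ ^ 2 ≤ Λ * α / (Λ - α) * ‖s‖ ^ 2 + Λ * ‖t‖ ^ 2 := by
  have hsq : ∀ w : ℂ, ‖w‖ ^ 2 = w.re ^ 2 + w.im ^ 2 := fun w => by
    rw [← Complex.normSq_eq_norm_sq, Complex.normSq_apply, sq, sq]
  have hd : 0 < Λ - α := sub_pos.mpr hα
  have key : ∀ x y : ℝ, α * (x + y) ^ 2 ≤ Λ * α / (Λ - α) * x ^ 2 + Λ * y ^ 2 := by
    intro x y
    have : Λ * α / (Λ - α) * x ^ 2 + Λ * y ^ 2 - α * (x + y) ^ 2 =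
        (α * x - (Λ - α) * y) ^ 2 / (Λ - α) := by
      field_simp
      ring
    have h2 : 0 ≤ (α * x - (Λ - α) * y) ^ 2 / (Λ - α) := by positivity
    linarith
  rw [hsq, hsq, hsq, Complex.add_re, Complex.add_im]
  linarith [key s.re t.re, key s.im t.im]

/-- Split `v = u + w` with `u` in the span of `η`. The form of `X` at `v` is at most the `g(α)` form
at `u` plus `Λ ‖w‖²`, by the scalar inequality and Bessel for `ξ`; `hCle` passes from `g(α)` to
`g(β)`. The optimal split turns the resulting bound into exactly the form of `Y`. -/
theorem spectralOperator_le {ξ : ι → H} {η : κ → H} (hξ : Orthonormal ℂ ξ) (hη : Orthonormal ℂ η)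
    {C : ι → κ → ℝ} (hC : ∀ i j, inner ℂ (ξ i) (η j) = (C i j : ℂ)) {Λ : ℝ} (hΛ : 0 < Λ)
    {α : ι → ℝ} {β : κ → ℝ} (hα : ∀ i, α i < Λ) (hβ : ∀ j, β j < Λ)
    (hCle : ∀ u : κ → ℝ, ∑ i, Λ * α i / (Λ - α i) * (C i ⬝ᵥ u) ^ 2 ≤
      ∑ j, Λ * β j / (Λ - β j) * u j ^ 2) :
    (spectralOperator Λ β η - spectralOperator 0 α ξ).IsPositive := by
  classical
  refine ⟨(spectralOperator_isSymmetric _ _ _).sub (spectralOperator_isSymmetric _ _ _),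
    fun v => ?_⟩
  change 0 ≤ (inner ℂ ((spectralOperator Λ β η - spectralOperator 0 α ξ) v) v).re
  rw [LinearMap.sub_apply, inner_sub_left, Complex.sub_re, re_inner_spectralOperator,
    re_inner_spectralOperator, sub_nonneg]
  simp only [zero_mul, zero_add, sub_zero]
  set y : κ → ℂ := fun j => inner ℂ (η j) v with hy
  -- `a = θ j * y j` minimizes `g(β j) ‖a‖² + Λ ‖y j - a‖²`, with minimum `β j ‖y j‖²`.
  set θ : κ → ℝ := fun j => 1 - β j / Λ with hθ
  set u : H := ∑ j, ((θ j : ℂ) * y j) • η j with hu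
  set w : H := v - u with hw
  have hξu : ∀ i, inner ℂ (ξ i) u = ∑ j, (C i j : ℂ) * (θ j * y j) := by
    intro i
    simp only [hu, inner_sum, inner_smul_right, hC]
    exact Finset.sum_congr rfl fun j _ => by ring
  have hnormw : ‖w‖ ^ 2 = ‖v‖ ^ 2 - ∑ j, (2 * θ j - θ j ^ 2) * ‖y j‖ ^ 2 := by
    have h1 : (inner ℂ v u).re = ∑ j, θ j * ‖y j‖ ^ 2 := by
      rw [hu, inner_sum, Complex.re_sum]
      refine Finset.sum_congr rfl fun j _ => ?_
      rw [inner_smul_right, ← inner_conj_symm, mul_assoc, Complex.re_ofReal_mul, Complex.mul_conj,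
        Complex.ofReal_re, Complex.normSq_eq_norm_sq]
    have h2 : ‖u‖ ^ 2 = ∑ j, θ j ^ 2 * ‖y j‖ ^ 2 := by
      have : (inner ℂ u u).re = ‖u‖ ^ 2 := inner_self_eq_norm_sq (𝕜 := ℂ) u
      rw [← this, hu, hη.inner_sum, Complex.re_sum]
      refine Finset.sum_congr rfl fun j _ => ?_
      rw [← Complex.normSq_eq_conj_mul_self, Complex.ofReal_re, Complex.normSq_mul,
        Complex.normSq_ofReal, Complex.normSq_eq_norm_sq, sq (θ j)]
    rw [hw, norm_sub_sq (𝕜 := ℂ), h2]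
    change ‖v‖ ^ 2 - 2 * (inner ℂ v u).re + _ = _
    rw [h1]
    simp only [sub_mul, Finset.sum_sub_distrib, mul_assoc, ← Finset.mul_sum]
    ring
  calc ∑ i, α i * ‖inner ℂ (ξ i) v‖ ^ 2
      ≤ ∑ i, (Λ * α i / (Λ - α i) * ‖inner ℂ (ξ i) u‖ ^ 2 + Λ * ‖inner ℂ (ξ i) w‖ ^ 2) := by
        refine Finset.sum_le_sum fun i _ => ?_
        have : v = u + w := by rw [hw]; abel
        conv_lhs => rw [this, inner_add_right]
        exact mul_norm_add_sq_le (hα i) _ _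
    _ ≤ ∑ j, Λ * β j / (Λ - β j) * ‖(θ j : ℂ) * y j‖ ^ 2 + Λ * ‖w‖ ^ 2 := by
        rw [Finset.sum_add_distrib, ← Finset.mul_sum]
        simp only [hξu]
        exact add_le_add (norm_sum_ofReal_mul_sq_le hCle _)
          (mul_le_mul_of_nonneg_left (hξ.sum_inner_products_le w) hΛ.le)
    _ = Λ * ‖v‖ ^ 2 + ∑ j, (β j - Λ) * ‖y j‖ ^ 2 := by
        rw [hnormw, mul_sub, Finset.mul_sum, add_sub_left_comm, ← Finset.sum_sub_distrib]
        congr 1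
        refine Finset.sum_congr rfl fun j _ => ?_
        have : Λ - β j ≠ 0 := (sub_pos.mpr (hβ j)).ne'
        rw [norm_mul, Complex.norm_real, mul_pow, Real.norm_eq_abs, sq_abs]
        simp only [hθ]
        field_simp
        ring

end SpectralOperator

/-! ### Spectra, multiplicities and the realizing matrices -/

section Realization

variable {ι : Type*} [Fintype ι] {n : ℕ}

theorem mem_eigSpace_iff {Z : Matrix (Fin n) (Fin n) ℂ} {z : ℝ} {v : EuclideanSpace ℂ (Fin n)} :
    v ∈ eigSpace Z z ↔ Matrix.toEuclideanLin Z v = (z : ℂ) • v :=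
  Module.End.mem_eigenspace_iff

theorem mem_spectrum_real_iff {Z : Matrix (Fin n) (Fin n) ℂ} {z : ℝ} :
    z ∈ spectrum ℝ Z ↔ ∃ v ≠ 0, Matrix.toEuclideanLin Z v = (z : ℂ) • v := by
  rw [← spectrum.algebraMap_mem_iff ℂ, ← Matrix.spectrum_toLpLin 2,
    ← Module.End.hasEigenvalue_iff_mem_spectrum]
  constructor
  · intro h
    obtain ⟨v, hv⟩ := h.exists_hasEigenvector
    exact ⟨v, hv.2, hv.apply_eq_smul⟩
  · rintro ⟨v, hv0, hv⟩
    exact Module.End.hasEigenvalue_of_hasEigenvector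
      (Module.End.hasEigenvector_iff.mpr ⟨Module.End.mem_eigenspace_iff.mpr hv, hv0⟩)

/-- Eigenvectors of a symmetric operator for different eigenvalues are orthogonal, so the projection
keeps exactly the terms with `α i = z`. -/
theorem prob_sum_eigenvectors {Z : Matrix (Fin n) (Fin n) ℂ}
    (hZ : (Matrix.toEuclideanLin Z).IsSymmetric) {ξ : ι → EuclideanSpace ℂ (Fin n)}
    (hξ : Orthonormal ℂ ξ) {α : ι → ℝ} (hα : ∀ i, Matrix.toEuclideanLin Z (ξ i) = (α i : ℂ) • ξ i)
    (x : ι → ℝ) (z : ℝ≥0) :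
    Prob Z (∑ i, (x i : ℂ) • ξ i) z = ∑ i, if α i = z then x i ^ 2 else 0 := by
  set c : ι → ℂ := fun i => if α i = z then (x i : ℂ) else 0 with hc
  have hproj : (eigSpace Z z).starProjection (∑ i, (x i : ℂ) • ξ i) = ∑ i, c i • ξ i := by
    refine Submodule.eq_starProjection_of_mem_of_inner_eq_zero ?_ fun w hw => ?_
    · refine Submodule.sum_mem _ fun i _ => ?_
      by_cases hi : α i = z
      · exact Submodule.smul_mem _ _ (mem_eigSpace_iff.mpr (by rw [hα, hi]))
      · simp [hc, hi]
    · rw [← Finset.sum_sub_distrib, sum_inner]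
      refine Finset.sum_eq_zero fun i _ => ?_
      by_cases hi : α i = z
      · simp [hc, hi]
      · have h1 := hZ (ξ i) w
        rw [hα, mem_eigSpace_iff.mp hw, inner_smul_left, inner_smul_right, Complex.conj_ofReal,
          ← sub_eq_zero, ← sub_mul, mul_eq_zero] at h1
        have h2 := h1.resolve_left fun h => hi (by exact_mod_cast sub_eq_zero.mp h)
        rw [← sub_smul, inner_smul_left, h2, mul_zero]
  rw [Prob, hproj, hξ.inner_sum, Complex.re_sum]
  refine Finset.sum_congr rfl fun i _ => ?_
  simp only [hc, Complex.conj_ofReal]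
  split_ifs
  · rw [← Complex.ofReal_mul, Complex.ofReal_re, sq]
  · simp

variable {Z : Matrix (Fin n) (Fin n) ℂ} {ξ : ι → EuclideanSpace ℂ (Fin n)} {c : ℝ} {α : ι → ℝ}

theorem simpleExcept_of_eq_spectralOperator (hξ : Orthonormal ℂ ξ) (hα : Function.Injective α)
    (hZ : Matrix.toEuclideanLin Z = spectralOperator c α ξ) : SimpleExcept Z c := by
  intro z hz hzc
  obtain ⟨v, hv0, hv⟩ := mem_spectrum_real_iff.mp hz
  rw [hZ] at hv
  obtain ⟨i, hi⟩ : ∃ i, α i = z := by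
    by_contra! h
    obtain ⟨hv1, hv2⟩ := hξ.eq_sum_of_spectralOperator_apply_eq hzc hv
    exact hv0 (hv1.trans (Finset.sum_eq_zero fun i _ => by rw [hv2 i (h i), zero_smul]))
  have hspan : eigSpace Z z = ℂ ∙ ξ i := by
    refine le_antisymm (fun w hw => ?_) ?_
    · rw [mem_eigSpace_iff, hZ] at hw
      obtain ⟨hw1, hw2⟩ := hξ.eq_sum_of_spectralOperator_apply_eq hzc hw
      rw [hw1]
      refine Submodule.sum_mem _ fun k _ => ?_
      by_cases hk : k = i
      · rw [hk]
        exact Submodule.smul_mem _ _ (Submodule.mem_span_singleton_self _)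
      · rw [hw2 k fun h => hk (hα (h.trans hi.symm)), zero_smul]
        exact Submodule.zero_mem _
    · rw [Submodule.span_singleton_le_iff_mem, mem_eigSpace_iff, hZ,
        hξ.spectralOperator_apply_self, hi]
  rw [hspan, finrank_span_singleton (hξ.ne_zero i)]

theorem range_subset_spectrum (hξ : Orthonormal ℂ ξ)
    (hZ : Matrix.toEuclideanLin Z = spectralOperator c α ξ) : Set.range α ⊆ spectrum ℝ Z := by
  rintro _ ⟨i, rfl⟩
  exact mem_spectrum_real_iff.mpr ⟨ξ i, hξ.ne_zero i, by rw [hZ, hξ.spectralOperator_apply_self]⟩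

theorem exists_inner_ne_zero_of_mem_spectrum (hξ : Orthonormal ℂ ξ)
    (hZ : Matrix.toEuclideanLin Z = spectralOperator c α ξ) {z : ℝ} (hz : z ∈ spectrum ℝ Z)
    (hzα : z ∉ Set.range α) :
    z = c ∧ ∃ v ≠ 0, ∀ i, inner ℂ (ξ i) v = 0 := by
  obtain ⟨v, hv0, hv⟩ := mem_spectrum_real_iff.mp hz
  rw [hZ] at hv
  have hzi : ∀ i, α i ≠ z := fun i h => hzα ⟨i, h⟩
  by_cases hzc : z = c
  · refine ⟨hzc, v, hv0, fun i => ?_⟩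
    have h1 := spectralOperator_isSymmetric c α ξ (ξ i) v
    rw [hξ.spectralOperator_apply_self, hv, inner_smul_left, inner_smul_right,
      Complex.conj_ofReal, ← sub_eq_zero, ← sub_mul, mul_eq_zero] at h1
    exact h1.resolve_left fun h => hzi i (by exact_mod_cast sub_eq_zero.mp h)
  · obtain ⟨hv1, hv2⟩ := hξ.eq_sum_of_spectralOperator_apply_eq hzc hv
    exact absurd (hv1.trans (Finset.sum_eq_zero fun i _ => by rw [hv2 i (hzi i), zero_smul])) hv0

/-- Too few vectors to span the space: a nonzero vector orthogonal to all `ξ i` is an eigenvector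
for `c`. -/
theorem spectrum_eq_of_card_lt (hξ : Orthonormal ℂ ξ)
    (hZ : Matrix.toEuclideanLin Z = spectralOperator c α ξ) (hn : Fintype.card ι < n) :
    spectrum ℝ Z = {c} ∪ Set.range α := by
  refine Set.Subset.antisymm (fun z hz => ?_) (Set.union_subset ?_ (range_subset_spectrum hξ hZ))
  · by_cases hzα : z ∈ Set.range α
    · exact Or.inr hzα
    · exact Or.inl (exists_inner_ne_zero_of_mem_spectrum hξ hZ hz hzα).1
  · rw [Set.singleton_subset_iff, mem_spectrum_real_iff]
    have hspan : (Submodule.span ℂ (Set.range ξ))ᗮ ≠ ⊥ := by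
      intro h
      rw [Submodule.orthogonal_eq_bot_iff] at h
      have := finrank_range_le_card (R := ℂ) ξ
      rw [Set.finrank, h, finrank_top, finrank_euclideanSpace_fin] at this
      omega
    obtain ⟨v, hv, hv0⟩ := Submodule.exists_mem_ne_zero_of_ne_bot hspan
    refine ⟨v, hv0, ?_⟩
    rw [hZ, spectralOperator_apply_of_orthogonal c α fun i =>
      (Submodule.mem_orthogonal _ _).mp hv _ (Submodule.subset_span ⟨i, rfl⟩)]

theorem spectrum_eq_of_card_eq (hξ : Orthonormal ℂ ξ)
    (hZ : Matrix.toEuclideanLin Z = spectralOperator c α ξ) (hn : Fintype.card ι = n) :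
    spectrum ℝ Z = Set.range α := by
  refine Set.Subset.antisymm (fun z hz => ?_) (range_subset_spectrum hξ hZ)
  by_contra hzα
  obtain ⟨-, v, hv0, hv⟩ := exists_inner_ne_zero_of_mem_spectrum hξ hZ hz hzα
  have htop := hξ.linearIndependent.span_eq_top_of_card_eq_finrank'
    (by rw [hn, finrank_euclideanSpace_fin])
  refine hv0 ((Submodule.mem_bot ℂ).mp ?_)
  rw [← Submodule.top_orthogonal_eq_bot, ← htop, Submodule.mem_orthogonal]
  intro w hw
  induction hw using Submodule.span_induction with
  | mem w hw => obtain ⟨i, rfl⟩ := hw; exact hv i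
  | zero => exact inner_zero_left _
  | add u w _ _ hu hw => rw [inner_add_left, hu, hw, add_zero]
  | smul a w _ hw => rw [inner_smul_left, hw, mul_zero]

theorem realSupport_eq_range (p : ℝ≥0 →₀ ℝ≥0) :
    realSupport p = Set.range fun z : p.support => ((z : ℝ≥0) : ℝ) := by
  ext z
  simp [realSupport]

theorem prob_spectralOperator {p : ℝ≥0 →₀ ℝ≥0} {ξ : p.support → EuclideanSpace ℂ (Fin n)}
    (hξ : Orthonormal ℂ ξ)
    (hZ : Matrix.toEuclideanLin Z = spectralOperator c (fun z : p.support => ((z : ℝ≥0) : ℝ)) ξ) (z : ℝ≥0) :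
    (p z : ℝ) = Prob Z (∑ i : p.support, (Real.sqrt (p i) : ℂ) • ξ i) z := by
  rw [prob_sum_eigenvectors (hZ ▸ spectralOperator_isSymmetric _ _ _) hξ
    (fun i => by rw [hZ]; exact hξ.spectralOperator_apply_self _ _ i)]
  simp only [Real.sq_sqrt (NNReal.coe_nonneg _), NNReal.coe_inj]
  rw [Finset.sum_coe_sort p.support fun i => if i = z then (p i : ℝ) else 0, Finset.sum_ite_eq']
  split_ifs with h
  · rfl
  · rw [Finsupp.notMem_support_iff.mp h, NNReal.coe_zero]

theorem StrictlyValidTransition.exists_realization {p q : ℝ≥0 →₀ ℝ≥0}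
    (h : StrictlyValidTransition p q) {n : ℕ}
    (hn : p.support.card + q.support.card ≤ n + 1) :
    ∃ (Λ : ℝ) (X Y : Matrix (Fin n) (Fin n) ℂ) (ψ : EuclideanSpace ℂ (Fin n)),
      0 < Λ ∧ (∀ z ∈ realSupport p ∪ realSupport q, z < Λ) ∧ Expresses p q X Y ψ ∧
      SimpleExcept X 0 ∧ SimpleExcept Y Λ ∧
      (p.support.card < n → spectrum ℝ X = {0} ∪ realSupport p) ∧
      (p.support.card = n → spectrum ℝ X = realSupport p) ∧
      (q.support.card < n → spectrum ℝ Y = {Λ} ∪ realSupport q) ∧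
      (q.support.card = n → spectrum ℝ Y = realSupport q) := by
  set α : p.support → ℝ := fun z => ((z : ℝ≥0) : ℝ) with hα
  set β : q.support → ℝ := fun z => ((z : ℝ≥0) : ℝ) with hβ
  have hα0 : ∀ i, 0 ≤ α i := fun i => NNReal.coe_nonneg _
  have hβ0 : ∀ j, 0 ≤ β j := fun j => NNReal.coe_nonneg _
  have hαinj : Function.Injective α := NNReal.coe_injective.comp Subtype.val_injective
  have hβinj : Function.Injective β := NNReal.coe_injective.comp Subtype.val_injective
  obtain ⟨Λ, hΛ, hαΛ, hβΛ, hK⟩ := exists_cutoff (P := fun i : p.support => (p i : ℝ))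
    (Q := fun j : q.support => (q j : ℝ)) (fun i => NNReal.coe_nonneg _)
    (fun j => NNReal.coe_nonneg _) hα0 hβ0 h.sum_mul_lt
  -- This is the interpolation hypothesis for the weights `g(α)`, `g(β)` in place of `α`, `β`.
  have hg := sum_mul_moebius_le hΛ hαΛ hβΛ h.sum_mul_div_le hK
  have hsum := h.sum_eq
  set x : p.support → ℝ := fun i => Real.sqrt (p i) with hx
  set y : q.support → ℝ := fun j => Real.sqrt (q j) with hy
  have hx2 : ∀ i, x i ^ 2 = p i := fun i => Real.sq_sqrt (NNReal.coe_nonneg _)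
  have hy2 : ∀ j, y j ^ 2 = q j := fun j => Real.sq_sqrt (NNReal.coe_nonneg _)
  have hypos : ∀ j, 0 < y j := fun j => Real.sqrt_pos.mpr
    (NNReal.coe_pos.mpr (pos_iff_ne_zero.mpr (Finsupp.mem_support_iff.mp j.2)))
  simp only [← hx2, ← hy2] at hg hsum
  have : Nonempty q.support := by
    by_contra hempty
    rw [not_nonempty_iff] at hempty
    have h1 := h.sum_mul_lt
    rw [Finset.univ_eq_empty (α := q.support), Finset.sum_empty] at h1
    exact absurd h1 (not_lt.mpr (Finset.sum_nonneg fun i _ => by positivity))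
  have hy0 : y ≠ 0 := fun h0 => (hypos (Classical.arbitrary _)).ne' (congrFun h0 _)
  obtain ⟨C, hCy, hC1, hC2⟩ := exists_contraction hypos
    (fun i => div_nonneg (mul_nonneg hΛ.le (hα0 i)) (sub_pos.mpr (hαΛ i)).le)
    (fun j => div_nonneg (mul_nonneg hΛ.le (hβ0 j)) (sub_pos.mpr (hβΛ j)).le) hsum hg
  have hcp : Fintype.card p.support = p.support.card := Fintype.card_coe _
  have hcq : Fintype.card q.support = q.support.card := Fintype.card_coe _
  obtain ⟨ξ, η, hξ, hη, hξη, hψ⟩ := exists_orthonormal_families hy0 hCy hsum hC1 (n := n)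
    (by rwa [hcp, hcq])
  set X := Matrix.toEuclideanLin.symm (spectralOperator 0 α ξ) with hX
  set Y := Matrix.toEuclideanLin.symm (spectralOperator Λ β η) with hY
  have hXT : Matrix.toEuclideanLin X = spectralOperator 0 α ξ := LinearEquiv.apply_symm_apply _ _
  have hYT : Matrix.toEuclideanLin Y = spectralOperator Λ β η := LinearEquiv.apply_symm_apply _ _
  have hXpos : X.PosSemidef := by
    rw [← Matrix.isPositive_toEuclideanLin_iff, hXT]
    refine ⟨spectralOperator_isSymmetric _ _ _, fun v => ?_⟩
    change 0 ≤ (inner ℂ _ v).re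
    rw [re_inner_spectralOperator, zero_mul, zero_add]
    exact Finset.sum_nonneg fun i _ => by
      rw [sub_zero]
      exact mul_nonneg (hα0 i) (sq_nonneg _)
  have hXY : X ≤ Y := by
    rw [Matrix.le_iff, ← Matrix.isPositive_toEuclideanLin_iff, map_sub, hXT, hYT]
    exact spectralOperator_le hξ hη hξη hΛ hαΛ hβΛ hC2
  refine ⟨Λ, X, Y, ∑ i, (x i : ℂ) • ξ i, hΛ, ?_,
    ⟨hXpos, Matrix.nonneg_iff_posSemidef.mp (hXpos.nonneg.trans hXY), hXY, prob_spectralOperator hξ hXT, ?_⟩,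
    simpleExcept_of_eq_spectralOperator hξ hαinj hXT,
    simpleExcept_of_eq_spectralOperator hη hβinj hYT, ?_, ?_, ?_, ?_⟩
  · rw [realSupport_eq_range, realSupport_eq_range]
    rintro z (⟨i, rfl⟩ | ⟨j, rfl⟩)
    · exact hαΛ i
    · exact hβΛ j
  · rw [hψ]
    exact prob_spectralOperator hη hYT
  all_goals
    intro hcard
    rw [realSupport_eq_range]
  · exact spectrum_eq_of_card_lt hξ hXT (hcp ▸ hcard)
  · exact spectrum_eq_of_card_eq hξ hXT (hcp ▸ hcard)
  · exact spectrum_eq_of_card_lt hη hYT (hcq ▸ hcard)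
  · exact spectrum_eq_of_card_eq hη hYT (hcq ▸ hcard)

theorem StrictlyValidTransition.card_support_pos {p q : ℝ≥0 →₀ ℝ≥0}
    (h : StrictlyValidTransition p q) : 0 < p.support.card ∧ 0 < q.support.card := by
  have hq : q ≠ 0 := by
    rintro rfl
    have := h.2 id continuous_id operatorMonotone_id ⟨0, 1, zero_ne_one⟩
    simp at this
  have hp : p ≠ 0 := by
    rintro rfl
    have h1 := h.1.1
    rw [Finsupp.support_zero, Finset.sum_empty, eq_comm, Finset.sum_eq_zero_iff] at h1
    exact hq (Finsupp.support_eq_empty.mp (Finset.eq_empty_of_forall_notMem fun z hz =>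
      Finsupp.mem_support_iff.mp hz (h1 z hz)))
  exact ⟨Finset.card_pos.mpr (Finsupp.support_nonempty_iff.mpr hp),
    Finset.card_pos.mpr (Finsupp.support_nonempty_iff.mpr hq)⟩

end Realization

theorem mainTheorem6 (p q : ℝ≥0 →₀ ℝ≥0) (h : StrictlyValidTransition p q) :
    (∃ (Λ : ℝ) (n : ℕ) (X Y : Matrix (Fin n) (Fin n) ℂ) (ψ : EuclideanSpace ℂ (Fin n)),
      0 < Λ ∧ (∀ z ∈ realSupport p ∪ realSupport q, z < Λ) ∧
      Expresses p q X Y ψ ∧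
      (spectrum ℝ X = {0} ∪ realSupport p ∨
        (q.support.card = 1 ∧ spectrum ℝ X = realSupport p)) ∧
      SimpleExcept X 0 ∧
      (spectrum ℝ Y = {Λ} ∪ realSupport q ∨
        (p.support.card = 1 ∧ spectrum ℝ Y = realSupport q)) ∧
      SimpleExcept Y Λ ∧
      n ≤ p.support.card + q.support.card - 1) ∧
    (∃ (Λ : ℝ) (n : ℕ) (X Y : Matrix (Fin n) (Fin n) ℂ) (ψ : EuclideanSpace ℂ (Fin n)),
      0 < Λ ∧ (∀ z ∈ realSupport p ∪ realSupport q, z < Λ) ∧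
      Expresses p q X Y ψ ∧
      spectrum ℝ X = {0} ∪ realSupport p ∧
      SimpleExcept X 0 ∧
      spectrum ℝ Y = {Λ} ∪ realSupport q ∧
      SimpleExcept Y Λ ∧
      n ≤ p.support.card + q.support.card) := by
  obtain ⟨hp, hq⟩ := h.card_support_pos
  constructor
  · obtain ⟨Λ, X, Y, ψ, hΛ, hlt, hE, hX, hY, hX₁, hX₂, hY₁, hY₂⟩ := h.exists_realization
      (n := p.support.card + q.support.card - 1) (by omega)
    refine ⟨Λ, _, X, Y, ψ, hΛ, hlt, hE, ?_, hX, ?_, hY, le_rfl⟩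
    -- In this dimension the `|S(p)|` eigenvectors of `X` form a basis exactly when `|S(q)| = 1`,
    -- leaving no complement for the extra eigenvalue; symmetrically for `Y`.
    · by_cases h1 : q.support.card = 1
      · exact Or.inr ⟨h1, hX₂ (by omega)⟩
      · exact Or.inl (hX₁ (by omega))
    · by_cases h1 : p.support.card = 1
      · exact Or.inr ⟨h1, hY₂ (by omega)⟩
      · exact Or.inl (hY₁ (by omega))
  -- One more dimension leaves a nonzero complement for both families, as both supports are
  -- nonempty.
  · obtain ⟨Λ, X, Y, ψ, hΛ, hlt, hE, hX, hY, hX₁, -, hY₁, -⟩ := h.exists_realization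
      (n := p.support.card + q.support.card) (by omega)
    exact ⟨Λ, _, X, Y, ψ, hΛ, hlt, hE, hX₁ (by omega), hX, hY₁ (by omega), hY, le_rfl⟩
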